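/- **Setting.** Let $f:\mathbb R\to\mathbb R$ be a $\mathcal C^\infty$ function all of whose derivatives grow at most polynomially at infinity, with $f''>0$ on $\mathbb R$. Let $\tilde p_1<p_1<p_2<\tilde p_2$ be real numbers. Let $\mathcal F u(p)=\int_{\mathbb R}u(x)e^{-ixp}\,dx$, and let $u_0\in\mathcal S(\mathbb R)$ be complex-valued with $\operatorname{supp}\mathcal F u_0\subseteq[p_1,p_2]$ and $\|u_0\|_{L^2(\mathbb R)}=1$. Put $$u_f(t,x)=\frac1{2\pi}\int_{\mathbb R}\mathcal F u_0(p)\,e^{-itf(p)+ixp}\,dp ,\qquad \mathcal M_1(u)=\int_{\mathbb R}x|u(x)|^2dx,\qquad \mathcal V(u)=\int_{\mathbb R}x^2|u(x)|^2dx-\mathcal M_1(u)^2 .$$ For $(t_0,x_0)\in\mathbb R^2$ let $$\mathfrak C(t_0,x_0)=\Big\{(t,x)\in(\mathbb R\setminus\{t_0\})\times\mathbb R:\ f'(\tilde p_1)\le\tfrac{x-x_0}{t-t_0}\le f'(\tilde p_2)\Big\},$$ let $\mathfrak C(t_0,x_0)^c$ be its complement in $(\mathbb R\setminus\{t_0\})\times\mathbb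 R$, and let $N(t_0,x_0)=\|(\cdot-x_0)\,u_f(t_0,\cdot)\|_{L^2(\mathbb R)}$. **Constants.** Let $M_2=\|f''\|_{L^\infty(\tilde p_1,\tilde p_2)}$, $M_3=\|f^{(3)}\|_{L^\infty(\tilde p_1,\tilde p_2)}$, $m=\min_{[\tilde p_1,\tilde p_2]}f''$, $\mu=\min\{f'(p_1)-f'(\tilde p_1),\,f'(\tilde p_2)-f'(p_2)\}$ and, for $\delta\in(\frac12,\frac34)$, $L(\delta)=\frac{\sqrt\pi}2\Big(\frac1{2\sqrt\pi}+\sqrt{\frac1{4\pi}+\frac12}\Big)^{2\delta-1}$. Let $$C_5(\delta)=\frac{2^{\delta+\frac12}L(\delta)}{\sqrt\pi\sqrt{3-4\delta}}(\tilde p_2-\tilde p_1)^{\frac{3-4\delta}2}M_2^{\frac32-\delta}m^{-\frac32},$$ $$C_6(\delta)=\frac{2^{\delta-2}L(\delta)}{\pi(1-\delta)}(\tilde p_2-\tilde p_1)^{2-2\delta}\Big(M_2^{\frac52-\delta}M_3\,m^{-\frac72}+\tfrac13M_2^{\frac72-\delta}M_3\,m^{-\frac92}\Big),$$ $$C_7=\frac{(p_2-p_1)^{\frac12}}{\sqrt{2\pi}\,\mu},\qquad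 C_8=\frac1{2\pi\mu}.$$ For $w\ge0$ and $r>0$ let $B^{\mathrm{in}}_\delta(w,r)=\big(C_5(\delta)\,w+C_6(\delta)\|u_0\|_{L^1(\mathbb R)}\big)r^{-\delta}$ and $B^{\mathrm{out}}(w,r)=\big(C_7\,w+C_8\|u_0\|_{L^1(\mathbb R)}\big)r^{-1}$. For a cone origin $(t_0,x_0)$, the error bounds are $B^{\mathrm{in}}_\delta(N(t_0,x_0),|t-t_0|)$ inside the cone and $B^{\mathrm{out}}(N(t_0,x_0),|t-t_0|)$ outside it. **Corollary 3.7.** For all $\tau$ and all $(t_0,x_0)$, $\|u_f(\tau,\cdot)\|_{L^2(\mathbb R)}=1$, the first and second moments of $|u_f(\tau,\cdot)|^2$ exist, $\mathcal V(u_f(\tau,\cdot))\ge0$, and $N(t_0,x_0)<\infty$. The function $\tau\mapsto\mathcal V(u_f(\tau,\cdot))$ has a unique global minimiser $t^*\in\mathbb R$. Put $x^*=\mathcal M_1(u_f(t^*,\cdot))$ and $\sigma=\min_{\tau\in\mathbb R}\sqrt{\mathcal V(u_f(\tau,\cdot))}$. Then: 1. $N(t^*,x^*)=\sigma$, and for every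 fixed elapsed time $r=|t-t_0|>0$ the two bounds, as functions of the origin, have a global minimum at $(t^*,x^*)$: for all $(t_0,x_0)\in\mathbb R^2$ and $\delta\in(\frac12,\frac34)$, $$B^{\mathrm{in}}_\delta(N(t^*,x^*),r)\le B^{\mathrm{in}}_\delta(N(t_0,x_0),r),\qquad B^{\mathrm{out}}(N(t^*,x^*),r)\le B^{\mathrm{out}}(N(t_0,x_0),r).$$ 2. For all $\delta\in(\frac12,\frac34)$ and $(t,x)\in\mathfrak C(t^*,x^*)$, with $p_0=(f')^{-1}\big(\frac{x-x^*}{t-t^*}\big)$, $$\left|u_f(t,x)-\frac1{\sqrt{2\pi}}\,e^{-\operatorname{sgn}(t-t^*)i\frac\pi4}\,e^{-itf(p_0)+ixp_0}\,\frac{\mathcal F u_0(p_0)}{\sqrt{f''(p_0)}}\,|t-t^*|^{-\frac12}\right|\le\big(C_5(\delta)\,\sigma+C_6(\delta)\|u_0\|_{L^1(\mathbb R)}\big)|t-t^*|^{-\delta}.$$ 3. For all $(t,x)\in\mathfrak C(t^*,x^*)^c$, $$|u_f(t,x)|\le\big(C_7\,\sigma+C_8\|u_0\|_{L^1(\mathbb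 R)}\big)|t-t^*|^{-1}.$$ -/

import Mathlib

open MeasureTheory Set
open scoped ENNReal SchwartzMap

namespace WavePacket

noncomputable section

/-- The Fourier transform with the convention `ℱ u (p) = ∫ u(x) e^{-ixp} dx`. -/
def fourierT (u : ℝ → ℂ) (p : ℝ) : ℂ :=
  ∫ x : ℝ, u x * Complex.exp (-(Complex.I * x * p))

/-- The wave packet `u_f(t,x) = (2π)⁻¹ ∫ ℱu₀(p) e^{-itf(p)+ixp} dp`, that is
`u_f(t) = ℱ⁻¹ (e^{-itf} ℱ u₀)`. -/
def wave (f : ℝ → ℝ) (u₀ : ℝ → ℂ) (t x : ℝ) : ℂ :=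
  1 / (2 * Real.pi) *
    ∫ p : ℝ, fourierT u₀ p * Complex.exp (-(Complex.I * t * f p) + Complex.I * x * p)

/-- `𝓜_w(u) = ∫ w(x) |u(x)|² dx`. -/
def moment (w : ℝ → ℝ) (u : ℝ → ℂ) : ℝ := ∫ x : ℝ, w x * ‖u x‖ ^ 2

/-- `𝓜₁(u)`, the mean position. -/
def mean (u : ℝ → ℂ) : ℝ := moment (fun x => x) u

/-- `𝓥(u) = 𝓜₂(u) - 𝓜₁(u)²`, the variance. -/
def variance (u : ℝ → ℂ) : ℝ := moment (fun x => x ^ 2) u - mean u ^ 2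

/-- `u` is `L²`-normalised and its first and second moments exist. -/
structure HasVariance (u : ℝ → ℂ) : Prop where
  memLp : MemLp u 2 volume
  norm_eq_one : lpNorm u 2 volume = 1
  integrable_one : Integrable (fun x : ℝ => x * ‖u x‖ ^ 2) volume
  integrable_two : Integrable (fun x : ℝ => x ^ 2 * ‖u x‖ ^ 2) volume

/-- The function `(· - x₀) u_f(t₀,·)`. -/
def weighted (f : ℝ → ℝ) (u₀ : ℝ → ℂ) (t₀ x₀ : ℝ) (x : ℝ) : ℂ :=
  ((x - x₀ : ℝ) : ℂ) * wave f u₀ t₀ x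

/-- The space-time cone with origin `(t₀,x₀)` of the frequency band `[a,b]`. -/
def cone (f : ℝ → ℝ) (a b t₀ x₀ : ℝ) : Set (ℝ × ℝ) :=
  {z | z.1 ≠ t₀ ∧ deriv f a ≤ (z.2 - x₀) / (z.1 - t₀) ∧ (z.2 - x₀) / (z.1 - t₀) ≤ deriv f b}

/-- The complement of the cone in `(ℝ \ {t₀}) × ℝ`. -/
def coneCompl (f : ℝ → ℝ) (a b t₀ x₀ : ℝ) : Set (ℝ × ℝ) :=
  {z | z.1 ≠ t₀} \ cone f a b t₀ x₀

/-- `p₀(t,x) = (f')⁻¹ ((x - x₀) / (t - t₀))`; here `f'` is injective, and the argument is in its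
range when `(t,x)` is in a cone with origin `(t₀,x₀)`. -/
def statPoint (f : ℝ → ℝ) (t₀ x₀ t x : ℝ) : ℝ :=
  Function.invFun (deriv f) ((x - x₀) / (t - t₀))

/-- The first term of the expansion with respect to the cone origin `(t₀,x₀)`. -/
def firstTerm (f : ℝ → ℝ) (u₀ : ℝ → ℂ) (t₀ x₀ t x : ℝ) : ℂ :=
  let p₀ := statPoint f t₀ x₀ t x
  1 / (Real.sqrt (2 * Real.pi) : ℂ)
    * Complex.exp (-(Real.sign (t - t₀) * Complex.I * (Real.pi / 4)))
    * Complex.exp (-(Complex.I * t * f p₀) + Complex.I * x * p₀)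
    * (fourierT u₀ p₀ / (Real.sqrt (iteratedDeriv 2 f p₀) : ℂ))
    * ((|t - t₀| ^ (-(1 / 2) : ℝ) : ℝ) : ℂ)

/-- `‖g‖_{L^∞(a,b)}`. -/
def supNorm (g : ℝ → ℝ) (a b : ℝ) : ℝ := lpNorm g ∞ (volume.restrict (Ioo a b))

/-- `min_{[a,b]} g`, for continuous `g` and `a ≤ b`. -/
def minOn (g : ℝ → ℝ) (a b : ℝ) : ℝ := sInf (g '' Icc a b)

/-- `L(δ)`. -/
def constL (δ : ℝ) : ℝ :=
  Real.sqrt Real.pi / 2 *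
    (1 / (2 * Real.sqrt Real.pi) + Real.sqrt (1 / (4 * Real.pi) + 1 / 2)) ^ (2 * δ - 1)

/-- `c₅(f,δ,a,b)`. -/
def smallC5 (f : ℝ → ℝ) (δ a b : ℝ) : ℝ :=
  supNorm (iteratedDeriv 2 f) a b ^ (3 / 2 - δ) * minOn (iteratedDeriv 2 f) a b ^ (-(3 / 2) : ℝ)

/-- `c₆(f,δ,a,b)`. -/
def smallC6 (f : ℝ → ℝ) (δ a b : ℝ) : ℝ :=
  supNorm (iteratedDeriv 2 f) a b ^ (5 / 2 - δ) * supNorm (iteratedDeriv 3 f) a b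
      * minOn (iteratedDeriv 2 f) a b ^ (-(7 / 2) : ℝ)
    + 1 / 3 * (supNorm (iteratedDeriv 2 f) a b ^ (7 / 2 - δ) * supNorm (iteratedDeriv 3 f) a b
      * minOn (iteratedDeriv 2 f) a b ^ (-(9 / 2) : ℝ))

/-- `C₅(f,δ,a,b)`. -/
def constC5 (f : ℝ → ℝ) (δ a b : ℝ) : ℝ :=
  (2 : ℝ) ^ (δ + 1 / 2) * constL δ / (Real.sqrt Real.pi * Real.sqrt (3 - 4 * δ))
    * (b - a) ^ ((3 - 4 * δ) / 2) * smallC5 f δ a b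

/-- `C₆(f,δ,a,b)`. -/
def constC6 (f : ℝ → ℝ) (δ a b : ℝ) : ℝ :=
  (2 : ℝ) ^ (δ - 2) * constL δ / (Real.pi * (1 - δ))
    * (b - a) ^ (2 - 2 * δ) * smallC6 f δ a b

/-- `C₇(f,p₁,p₂,a,b)`. -/
def constC7 (f : ℝ → ℝ) (p₁ p₂ a b : ℝ) : ℝ :=
  1 / Real.sqrt (2 * Real.pi) * Real.sqrt (p₂ - p₁)
    * (min (deriv f p₁ - deriv f a) (deriv f b - deriv f p₂))⁻¹

/-- `C₈(f,p₁,p₂,a,b)`. -/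
def constC8 (f : ℝ → ℝ) (p₁ p₂ a b : ℝ) : ℝ :=
  1 / (2 * Real.pi) * (min (deriv f p₁ - deriv f a) (deriv f b - deriv f p₂))⁻¹

/-- The error bound inside the cone, where `m` is the value of the weight and
`r` is the elapsed time `|t - t₀|`. -/
def innerBound (f : ℝ → ℝ) (u₀ : ℝ → ℂ) (δ a b m r : ℝ) : ℝ :=
  (constC5 f δ a b * m + constC6 f δ a b * lpNorm u₀ 1 volume) * r ^ (-δ)

/-- The bound outside the cone, where `m` is the value of the weight and
`r` is the elapsed time `|t - t₀|`. -/
def outerBound (f : ℝ → ℝ) (u₀ : ℝ → ℂ) (p₁ p₂ a b m r : ℝ) : ℝ :=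
  (constC7 f p₁ p₂ a b * m + constC8 f p₁ p₂ a b * lpNorm u₀ 1 volume) * r⁻¹

end

end WavePacket

namespace WavePacket

noncomputable section

/-! The wave packet is invariant under a change of origin: for every `(t₀,x₀)` it is an oscillatory
integral with phase `(t-t₀)f(p)-(x-x₀)p` and amplitude `originProfile`, the Fourier transform of
`u_f(t₀,·+x₀)`. The amplitude always has modulus `|ℱu₀|`, bounded by `‖u₀‖₁`. By Plancherel its
derivative has squared `L²` norm `2π N(t₀,x₀)²`. So any estimate that uses only these two norms
holds at every origin, and the origin enters the bounds only through `N` and the elapsed time.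

There are two such estimates. Inside the cone the phase has one critical point in the band. The
substitution `s = √h`, where `h` is the phase up to sign minus its critical value, reduces it to
`e^{-is²}`, and one integration by parts against `fresnel`, the primitive vanishing at infinity,
leaves a remainder controlled by `‖fresnel s‖ ≤ L(δ) s^{1-2δ}` (`IsPhase.norm_integral_sub_le`,
`norm_wave_sub_firstTerm_le`). Outside the cone the phase derivative is at least `|t-t₀|μ` in
modulus on the support, and an ordinary integration by parts suffices (`norm_wave_le_outerBound`).

Choosing the origin is then minimising `N`. The parallel axis identity
`lpNorm_weighted_sq_eq_variance` splits `N²` into the variance at time `t₀` plus the squared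
distance from `x₀` to the mean. In frequency space `N²` is a quadratic polynomial in `(t₀,x₀)`, so
the variance is quadratic in time; its leading coefficient is the variance of the velocity `f'`,
positive because `f'` is injective and an open support is not a point (`velocityMoment_one_sq_lt`).
Hence the variance has a unique minimiser, and the mean there gives the optimal origin. Both bounds
increase with `N`. -/

/-! ### Fourier conventions and Plancherel -/

open FourierTransform in
lemma fourierT_eq_fourier (u : ℝ → ℂ) (p : ℝ) :
    fourierT u p = 𝓕 u (p / (2 * Real.pi)) := by
  rw [Real.fourier_eq', fourierT]
  congr 1 with x
  rw [smul_eq_mul, mul_comm]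
  congr 2
  have := Real.pi_ne_zero
  simp only [RCLike.inner_apply, conj_trivial]
  push_cast
  have : (Real.pi : ℂ) ≠ 0 := by exact_mod_cast this
  field_simp

/-- The inverse Fourier transform, in the normalisation of `wave`. -/
def invFourierT (V : ℝ → ℂ) (x : ℝ) : ℂ :=
  1 / (2 * Real.pi) * ∫ p : ℝ, V p * Complex.exp (Complex.I * x * p)

open FourierTransform in
lemma invFourierT_eq_fourier (V : ℝ → ℂ) (x : ℝ) :
    invFourierT V x = 𝓕 (fun ξ : ℝ => V (2 * Real.pi * ξ)) (-x) := by
  have hpi := Real.pi_pos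
  have := Measure.integral_comp_mul_left
    (fun p : ℝ => V p * Complex.exp (Complex.I * x * p)) (2 * Real.pi)
  rw [Real.fourier_eq', invFourierT]
  rw [abs_of_pos (by positivity)] at this
  have h2 : (1 / (2 * Real.pi) * ∫ p : ℝ, V p * Complex.exp (Complex.I * x * p) : ℂ)
      = (2 * Real.pi)⁻¹ • ∫ p : ℝ, V p * Complex.exp (Complex.I * x * p) := by
    rw [Complex.real_smul]; push_cast; ring
  rw [h2, ← this]
  congr 1 with ξ
  rw [smul_eq_mul, mul_comm]
  congr 2
  simp only [RCLike.inner_apply, conj_trivial]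
  push_cast
  ring

lemma fourierT_contDiff (u : 𝓢(ℝ, ℂ)) : ContDiff ℝ (⊤ : ℕ∞) (fourierT u) := by
  have : fourierT u = fun p => (FourierTransform.fourier u : 𝓢(ℝ, ℂ)) (p / (2 * Real.pi)) := by
    ext p; rw [fourierT_eq_fourier, SchwartzMap.fourier_coe]
  rw [this]
  exact ((FourierTransform.fourier u : 𝓢(ℝ, ℂ)).smooth ⊤).comp (contDiff_id.div_const _)

lemma integral_norm_sq_fourierT (u : 𝓢(ℝ, ℂ)) :
    1 / (2 * Real.pi) * ∫ p : ℝ, ‖fourierT u p‖ ^ 2 = ∫ x : ℝ, ‖u x‖ ^ 2 := by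
  rw [← SchwartzMap.integral_norm_sq_fourier]
  have := Measure.integral_comp_div
    (fun p : ℝ => ‖(FourierTransform.fourier u : 𝓢(ℝ, ℂ)) p‖ ^ 2) (2 * Real.pi)
  simp only [SchwartzMap.fourier_coe, ← fourierT_eq_fourier] at this ⊢
  rw [this, abs_of_pos (by positivity), smul_eq_mul, ← mul_assoc, one_div_mul_cancel, one_mul]
  positivity

lemma norm_fourierT_le (u : ℝ → ℂ) (p : ℝ) : ‖fourierT u p‖ ≤ ∫ x : ℝ, ‖u x‖ := by
  refine (norm_integral_le_integral_norm _).trans_eq ?_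
  congr 1 with x
  rw [norm_mul, Complex.norm_exp]
  simp

section

variable {V : ℝ → ℂ}

lemma hasCompactSupport_comp_mul (hs : HasCompactSupport V) :
    HasCompactSupport (fun ξ : ℝ => V (2 * Real.pi * ξ)) :=
  hs.comp_homeomorph (Homeomorph.mulLeft₀ (2 * Real.pi) (by positivity))

lemma contDiff_comp_mul (hV : ContDiff ℝ (⊤ : ℕ∞) V) :
    ContDiff ℝ (⊤ : ℕ∞) (fun ξ : ℝ => V (2 * Real.pi * ξ)) :=
  hV.comp (contDiff_const.mul contDiff_id)

/-- The inverse Fourier transform of a test function is a Schwartz function. -/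
lemma exists_schwartz_eq_invFourierT (hV : ContDiff ℝ (⊤ : ℕ∞) V) (hs : HasCompactSupport V) :
    ∃ w : 𝓢(ℝ, ℂ), ⇑w = invFourierT V := by
  refine ⟨FourierTransform.fourierInv
    ((hasCompactSupport_comp_mul hs).toSchwartzMap (contDiff_comp_mul hV)), ?_⟩
  ext x
  rw [invFourierT_eq_fourier, ← Real.fourierInv_eq_fourier_neg, SchwartzMap.fourierInv_coe]
  rfl

lemma integral_norm_sq_invFourierT (hV : ContDiff ℝ (⊤ : ℕ∞) V) (hs : HasCompactSupport V) :
    ∫ x : ℝ, ‖invFourierT V x‖ ^ 2 = 1 / (2 * Real.pi) * ∫ p : ℝ, ‖V p‖ ^ 2 := by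
  simp only [invFourierT_eq_fourier]
  rw [integral_neg_eq_self (fun x => ‖FourierTransform.fourier
    (fun ξ : ℝ => V (2 * Real.pi * ξ)) x‖ ^ 2)]
  have := SchwartzMap.integral_norm_sq_fourier
    ((hasCompactSupport_comp_mul hs).toSchwartzMap (contDiff_comp_mul hV))
  rw [SchwartzMap.fourier_coe] at this
  refine this.trans ?_
  have h2 := Measure.integral_comp_mul_left (fun p : ℝ => ‖V p‖ ^ 2) (2 * Real.pi)
  rw [abs_of_pos (by positivity), smul_eq_mul] at h2
  rw [one_div, ← h2]
  rfl

/-- This turns the weight `x` in position space into a derivative in frequency space, which is how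
`N(t₀,x₀)` enters the phase estimates. The factor `2π` in `hd` is the chain rule for the rescaling
to Mathlib's convention. -/
lemma invFourierT_deriv (hV : ContDiff ℝ (⊤ : ℕ∞) V) (hs : HasCompactSupport V) (x : ℝ) :
    invFourierT (deriv V) x = -(Complex.I * x) * invFourierT V x := by
  have hd : deriv (fun ξ : ℝ => V (2 * Real.pi * ξ))
      = fun ξ : ℝ => (2 * Real.pi) • deriv V (2 * Real.pi * ξ) := by
    ext ξ
    exact deriv_comp_mul_left (2 * Real.pi) V ξ
  have hc := contDiff_comp_mul hV
  have hcs := hasCompactSupport_comp_mul hs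
  have key := congrFun (Real.fourier_deriv (f := fun ξ : ℝ => V (2 * Real.pi * ξ))
    (hc.continuous.integrable_of_hasCompactSupport hcs)
    (hc.differentiable (by simp))
    ((hc.continuous_deriv (by simp)).integrable_of_hasCompactSupport hcs.deriv)) (-x)
  rw [hd] at key
  have h3 : FourierTransform.fourier (fun ξ : ℝ => (2 * Real.pi) • deriv V (2 * Real.pi * ξ)) (-x)
      = (2 * Real.pi : ℂ) * invFourierT (deriv V) x := by
    rw [invFourierT_eq_fourier, Real.fourier_eq', Real.fourier_eq', ← integral_const_mul]
    congr 1 with ξ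
    simp only [smul_eq_mul, Complex.real_smul]
    push_cast
    ring
  rw [h3, ← invFourierT_eq_fourier, smul_eq_mul] at key
  have hpi : (2 * Real.pi : ℂ) ≠ 0 := by
    have := Real.pi_ne_zero
    exact_mod_cast (by positivity : (2 * Real.pi) ≠ 0)
  apply mul_left_cancel₀ hpi
  rw [key]
  push_cast
  ring

lemma integral_sq_mul_norm_sq_invFourierT (hV : ContDiff ℝ (⊤ : ℕ∞) V) (hs : HasCompactSupport V) :
    ∫ x : ℝ, x ^ 2 * ‖invFourierT V x‖ ^ 2 = 1 / (2 * Real.pi) * ∫ p : ℝ, ‖deriv V p‖ ^ 2 := by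
  rw [← integral_norm_sq_invFourierT (V := deriv V)
    ((contDiff_infty_iff_deriv.1 hV).2) hs.deriv]
  congr 1 with x
  rw [invFourierT_deriv hV hs]
  simp [mul_pow]

end

lemma lpNorm_two_sq_eq_integral {u : ℝ → ℂ} (hu : AEStronglyMeasurable u volume) :
    lpNorm u 2 volume ^ 2 = ∫ x : ℝ, ‖u x‖ ^ 2 := by
  have h0 : 0 ≤ ∫ x : ℝ, ‖u x‖ ^ 2 := integral_nonneg fun x => by positivity
  have := lpNorm_nnreal_eq_integral_norm_rpow (p := 2) (by norm_num) hu
  norm_num at this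
  rw [this, ← Real.rpow_natCast, ← Real.rpow_mul h0]
  norm_num

/-! ### The Fresnel primitive and its decay -/

/-- The integrand of `fresnelAux`. -/
def fresnelKernel (s r : ℝ) : ℂ :=
  Complex.exp (-((Real.sqrt 2 : ℂ) * (1 + Complex.I) * s * r) - (r : ℂ) ^ 2)

/-- Up to the factor `e^{-is²}`, the integral of `e^{-iz²}` along the ray `s + e^{-iπ/4} [0,∞)`. -/
def fresnelAux (s : ℝ) : ℂ := ∫ r : ℝ in Ioi 0, fresnelKernel s r

/-- The primitive of `e^{-is²}` that vanishes at infinity. -/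
def fresnel (s : ℝ) : ℂ :=
  -((Real.sqrt 2 : ℂ) / 2 * (1 - Complex.I)) * (Complex.exp (-(Complex.I * s ^ 2)) * fresnelAux s)

lemma norm_fresnelKernel (s r : ℝ) :
    ‖fresnelKernel s r‖ = Real.exp (-(Real.sqrt 2 * s * r) - r ^ 2) := by
  rw [fresnelKernel, Complex.norm_exp]
  congr 1
  have : (-((Real.sqrt 2 : ℂ) * (1 + Complex.I) * s * r) - (r : ℂ) ^ 2)
      = ((-(Real.sqrt 2 * s * r) - r ^ 2 : ℝ) : ℂ) + ((-(Real.sqrt 2 * s * r) : ℝ) : ℂ) * Complex.I := by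
    push_cast; ring
  rw [this]
  simp only [Complex.add_re, Complex.ofReal_re, Complex.re_ofReal_mul, Complex.I_re]
  ring

lemma continuous_fresnelKernel (s : ℝ) : Continuous (fresnelKernel s) := by
  unfold fresnelKernel; fun_prop

lemma norm_sqrt_two_mul_one_add_I : ‖(Real.sqrt 2 : ℂ) * (1 + Complex.I)‖ = 2 := by
  rw [norm_mul, Complex.norm_real, Real.norm_of_nonneg (Real.sqrt_nonneg _), Complex.norm_def]
  have : Complex.normSq (1 + Complex.I) = 2 := by
    rw [Complex.normSq_apply]; norm_num
  rw [this, Real.mul_self_sqrt (by norm_num)]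

/-- Young's inequality `Cr ≤ C²/2 + r²/2` lets half of the Gaussian absorb the linear exponent,
uniformly in `s` as long as `C` is fixed. -/
lemma norm_fresnelKernel_le {s C r : ℝ} (hr : 0 ≤ r) (h : -(Real.sqrt 2 * s) ≤ C) :
    ‖fresnelKernel s r‖ ≤ Real.exp (C ^ 2 / 2) * Real.exp (-(1 / 2) * r ^ 2) := by
  rw [norm_fresnelKernel, ← Real.exp_add]
  apply Real.exp_le_exp.2
  nlinarith [sq_nonneg (r - C), mul_le_mul_of_nonneg_right h hr]

lemma integrable_fresnelKernel (s : ℝ) : Integrable (fresnelKernel s) (volume.restrict (Ioi 0)) := by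
  refine Integrable.mono' (g := fun r : ℝ =>
    Real.exp ((-(Real.sqrt 2 * s)) ^ 2 / 2) * Real.exp (-(1 / 2) * r ^ 2)) ?_
    (continuous_fresnelKernel s).aestronglyMeasurable ?_
  · exact ((integrable_exp_neg_mul_sq (by norm_num)).const_mul _).integrableOn
  · filter_upwards [ae_restrict_mem measurableSet_Ioi] with r hr
    exact norm_fresnelKernel_le (le_of_lt hr) le_rfl

lemma hasDerivAt_fresnelAux_integral (s : ℝ) :
    Integrable (fun r : ℝ => -((Real.sqrt 2 : ℂ) * (1 + Complex.I) * r) * fresnelKernel s r)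
        (volume.restrict (Ioi 0)) ∧
    HasDerivAt fresnelAux
      (∫ r : ℝ in Ioi 0, -((Real.sqrt 2 : ℂ) * (1 + Complex.I) * r) * fresnelKernel s r) s := by
  -- This dominates `-√2 z` for all `z` in the unit ball around `s`, giving one integrable bound for
  -- the whole neighbourhood.
  set C : ℝ := Real.sqrt 2 * (|s| + 1) with hC
  refine hasDerivAt_integral_of_dominated_loc_of_deriv_le (F := fresnelKernel)
    (F' := fun s r => -((Real.sqrt 2 : ℂ) * (1 + Complex.I) * r) * fresnelKernel s r)
    (bound := fun r : ℝ => 2 * Real.exp (C ^ 2 / 2) * (r * Real.exp (-(1 / 2) * r ^ 2)))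
    (Metric.ball_mem_nhds s one_pos)
    (.of_forall fun s => (continuous_fresnelKernel s).aestronglyMeasurable)
    (integrable_fresnelKernel s) ?_ ?_ ?_ ?_
  · refine Continuous.aestronglyMeasurable ?_
    have := continuous_fresnelKernel s
    fun_prop
  · filter_upwards [ae_restrict_mem measurableSet_Ioi] with r hr z hz
    have hr' : 0 < r := hr
    rw [Metric.mem_ball, Real.dist_eq] at hz
    have h1 : -(Real.sqrt 2 * z) ≤ C := by
      rw [hC, ← mul_neg]
      apply mul_le_mul_of_nonneg_left _ (Real.sqrt_nonneg _)
      have := abs_lt.1 hz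
      have := neg_abs_le s
      linarith
    rw [norm_mul, norm_neg, norm_mul, norm_sqrt_two_mul_one_add_I, Complex.norm_real,
      Real.norm_of_nonneg hr'.le]
    calc 2 * r * ‖fresnelKernel z r‖
        ≤ 2 * r * (Real.exp (C ^ 2 / 2) * Real.exp (-(1 / 2) * r ^ 2)) := by
          gcongr
          exact norm_fresnelKernel_le hr'.le h1
      _ = _ := by ring
  · exact ((integrable_mul_exp_neg_mul_sq (by norm_num)).const_mul _).integrableOn
  · filter_upwards with r z _
    unfold fresnelKernel
    have h1 : HasDerivAt (fun z : ℝ => (z : ℂ)) 1 z := Complex.ofRealCLM.hasDerivAt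
    have h2 := ((((h1.const_mul ((Real.sqrt 2 : ℂ) * (1 + Complex.I))).mul_const (r : ℂ)).neg).sub_const
      ((r : ℂ) ^ 2)).cexp
    refine h2.congr_deriv ?_
    simp only [Pi.neg_apply]
    ring

/-- With `κ = √2(1+i)`, the `r`-derivative of the kernel is `-(κs+2r)` times the kernel and
integrates to `-1`. This expresses the first moment of the kernel through its integral, and `κ² =
4i` gives the stated coefficients. -/
lemma hasDerivAt_fresnelAux (s : ℝ) :
    HasDerivAt fresnelAux
      (-((Real.sqrt 2 : ℂ) * (1 + Complex.I)) / 2 + 2 * Complex.I * s * fresnelAux s) s := by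
  obtain ⟨hi, hd⟩ := hasDerivAt_fresnelAux_integral s
  have hsq : (Real.sqrt 2 : ℂ) ^ 2 = 2 := by
    rw [← Complex.ofReal_pow, Real.sq_sqrt (by norm_num)]; norm_num
  set κ : ℂ := (Real.sqrt 2 : ℂ) * (1 + Complex.I) with hκ
  have hκ2 : κ ^ 2 = 4 * Complex.I := by
    rw [hκ, mul_pow, hsq, add_sq, Complex.I_sq]; ring
  convert hd using 1
  have hder : ∀ r : ℝ, HasDerivAt (fresnelKernel s) (-(κ * s + 2 * r) * fresnelKernel s r) r := by
    intro r
    unfold fresnelKernel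
    have h1 : HasDerivAt (fun z : ℝ => (z : ℂ)) 1 r := Complex.ofRealCLM.hasDerivAt
    have h2 := (((h1.const_mul (κ * s)).neg).sub (h1.pow 2)).cexp
    refine h2.congr_deriv ?_
    simp only [Pi.pow_apply, Pi.sub_apply, Pi.neg_apply, ← hκ]
    push_cast
    ring
  have hlim : Filter.Tendsto (fresnelKernel s) Filter.atTop (nhds 0) := by
    apply squeeze_zero_norm' (a := fun r : ℝ =>
      Real.exp ((-(Real.sqrt 2 * s)) ^ 2 / 2) * Real.exp (-(1 / 2) * r ^ 2))
    · filter_upwards [Filter.eventually_ge_atTop 0] with r hr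
      exact norm_fresnelKernel_le hr le_rfl
    · rw [← mul_zero (Real.exp ((-(Real.sqrt 2 * s)) ^ 2 / 2))]
      refine Filter.Tendsto.const_mul _ (Real.tendsto_exp_atBot.comp ?_)
      exact (Filter.tendsto_pow_atTop (by norm_num)).const_mul_atTop_of_neg (by norm_num)
  have hI : Integrable (fun r : ℝ => -(κ * s + 2 * r) * fresnelKernel s r)
      (volume.restrict (Ioi 0)) := by
    have h := ((integrable_fresnelKernel s).const_mul (-(κ * s))).add (hi.const_mul (2 / κ))
    refine h.congr (.of_forall fun r => ?_)
    have hκ0 : κ ≠ 0 := by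
      intro h0
      rw [h0] at hκ2
      simp at hκ2
    simp only [Pi.add_apply]
    field_simp
    ring
  have hftc := integral_Ioi_of_hasDerivAt_of_tendsto (a := 0)
    (continuous_fresnelKernel s).continuousWithinAt (fun r _ => hder r) hI hlim
  have h0 : fresnelKernel s 0 = 1 := by simp [fresnelKernel]
  rw [h0] at hftc
  have hsplit : ∫ r : ℝ in Ioi 0, -(κ * r) * fresnelKernel s r
      = κ / 2 * (∫ r : ℝ in Ioi 0, -(κ * s + 2 * r) * fresnelKernel s r)
        + κ ^ 2 / 2 * s * fresnelAux s := by
    rw [fresnelAux, ← integral_const_mul, ← integral_const_mul, ← integral_add (hI.const_mul _)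
      ((integrable_fresnelKernel s).const_mul _)]
    congr 1 with r
    ring
  rw [hsplit, hftc, hκ2]
  ring

/-- Differentiating `e^{-is²}` cancels the term `2is·fresnelAux s`, and the surviving constant is
`(√2/2)(1-i)·κ/2 = 1`. -/
lemma hasDerivAt_fresnel (s : ℝ) :
    HasDerivAt fresnel (Complex.exp (-(Complex.I * s ^ 2))) s := by
  have hsq : (Real.sqrt 2 : ℂ) ^ 2 = 2 := by
    rw [← Complex.ofReal_pow, Real.sq_sqrt (by norm_num)]; norm_num
  have h1 : HasDerivAt (fun z : ℝ => (z : ℂ)) 1 s := Complex.ofRealCLM.hasDerivAt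
  have h2 := (((((h1.pow 2).const_mul Complex.I).neg).cexp).mul (hasDerivAt_fresnelAux s)).const_mul
    (-((Real.sqrt 2 : ℂ) / 2 * (1 - Complex.I)))
  refine (h2.congr_deriv ?_)
  simp only [Pi.pow_apply, Pi.neg_apply]
  push_cast
  linear_combination ((1 : ℂ) / 4 * (1 - Complex.I ^ 2) * Complex.exp (-(Complex.I * s ^ 2))) * hsq
    - (1 / 2 * Complex.exp (-(Complex.I * s ^ 2))) * Complex.I_sq

lemma fresnel_zero :
    fresnel 0 = -((Real.sqrt 2 : ℂ) / 2 * (1 - Complex.I)) * ((Real.sqrt Real.pi / 2 : ℝ) : ℂ) := by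
  have h : fresnelAux 0 = ((Real.sqrt Real.pi / 2 : ℝ) : ℂ) := by
    have := integral_gaussian_Ioi 1
    rw [div_one] at this
    rw [← this, fresnelAux, ← integral_complex_ofReal]
    congr 1 with r
    simp [fresnelKernel]
  simp [fresnel, h]

lemma norm_fresnel (s : ℝ) : ‖fresnel s‖ = ‖fresnelAux s‖ := by
  have h1 : ‖Complex.exp (-(Complex.I * s ^ 2))‖ = 1 := by
    have : -(Complex.I * (s : ℂ) ^ 2) = ((-s ^ 2 : ℝ) : ℂ) * Complex.I := by push_cast; ring
    rw [this, Complex.norm_exp_ofReal_mul_I]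
  have h2 : ‖(Real.sqrt 2 : ℂ) / 2 * (1 - Complex.I)‖ = 1 := by
    have : ‖(1 - Complex.I)‖ = Real.sqrt 2 := by
      rw [Complex.norm_def, Complex.normSq_apply]; norm_num
    rw [norm_mul, norm_div, Complex.norm_real, Real.norm_of_nonneg (Real.sqrt_nonneg _), this,
      Complex.norm_ofNat, div_mul_eq_mul_div, Real.mul_self_sqrt (by norm_num)]
    norm_num
  rw [fresnel, norm_mul, norm_neg, h2, norm_mul, h1, one_mul, one_mul]

lemma norm_fresnel_le_const {s : ℝ} (hs : 0 ≤ s) : ‖fresnel s‖ ≤ Real.sqrt Real.pi / 2 := by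
  rw [norm_fresnel]
  have hg := integral_gaussian_Ioi 1
  rw [div_one] at hg
  rw [← hg, fresnelAux]
  refine norm_integral_le_of_norm_le (integrable_exp_neg_mul_sq one_pos).integrableOn ?_
  filter_upwards [ae_restrict_mem measurableSet_Ioi] with r hr
  rw [norm_fresnelKernel]
  apply Real.exp_le_exp.2
  have : 0 ≤ Real.sqrt 2 * s * r := by have : 0 < r := hr; positivity
  linarith

lemma norm_fresnel_le_inv {s : ℝ} (hs : 0 < s) : ‖fresnel s‖ ≤ 1 / (Real.sqrt 2 * s) := by
  rw [norm_fresnel]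
  have hneg : -(Real.sqrt 2 * s) < 0 := by
    have : 0 < Real.sqrt 2 * s := by positivity
    linarith
  have hg := integral_exp_mul_Ioi hneg 0
  rw [mul_zero, Real.exp_zero, neg_div_neg_eq] at hg
  rw [← hg, fresnelAux]
  refine norm_integral_le_of_norm_le (integrableOn_exp_mul_Ioi hneg 0) ?_
  filter_upwards [ae_restrict_mem measurableSet_Ioi] with r hr
  rw [norm_fresnelKernel]
  apply Real.exp_le_exp.2
  nlinarith [sq_nonneg r]

/-- Write `c = √π/2` and `K` for the bracket in `constL`, so that `L(δ) = c K^{2δ-1}`. The decay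
bound `1/(√2 s)` fits this constant once `1/√2 ≤ cK`; here `cK = 1/4 + √(1/4+π/2)/2` exceeds `0.8`.
-/
lemma sqrt_pi_bound :
    1 / Real.sqrt 2 ≤ Real.sqrt Real.pi / 2 *
      (1 / (2 * Real.sqrt Real.pi) + Real.sqrt (1 / (4 * Real.pi) + 1 / 2)) := by
  have hpi := Real.pi_gt_three
  have hp0 := Real.pi_pos
  have e : Real.sqrt Real.pi * Real.sqrt (1 / (4 * Real.pi) + 1 / 2)
      = Real.sqrt (1 / 4 + Real.pi / 2) := by
    rw [← Real.sqrt_mul hp0.le]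
    congr 1
    field_simp
  have h1 : (1.3 : ℝ) ≤ Real.sqrt (1 / 4 + Real.pi / 2) :=
    Real.le_sqrt_of_sq_le (by norm_num; linarith)
  have h2 : 1 / Real.sqrt 2 ≤ 0.8 := by
    rw [div_le_iff₀ (by positivity)]
    have : (1.4 : ℝ) ≤ Real.sqrt 2 := Real.le_sqrt_of_sq_le (by norm_num)
    linarith
  have h3 : Real.sqrt Real.pi / 2 *
      (1 / (2 * Real.sqrt Real.pi) + Real.sqrt (1 / (4 * Real.pi) + 1 / 2))
      = 1 / 4 + Real.sqrt (1 / 4 + Real.pi / 2) / 2 := by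
    rw [← e]
    have : Real.sqrt Real.pi ≠ 0 := by positivity
    field_simp
    ring
  rw [h3]
  linarith

lemma constL_pos (δ : ℝ) : 0 < constL δ := by unfold constL; positivity

/-- Geometric interpolation between the constant bound, with weight `2-2δ`, and the `1/s` bound,
with weight `2δ-1`. -/
lemma norm_fresnel_le {δ s : ℝ} (hδ : δ ∈ Ioo (1 / 2 : ℝ) (3 / 4)) (hs : 0 < s) :
    ‖fresnel s‖ ≤ constL δ * s ^ (1 - 2 * δ) := by
  set c := Real.sqrt Real.pi / 2 with hc
  set K := 1 / (2 * Real.sqrt Real.pi) + Real.sqrt (1 / (4 * Real.pi) + 1 / 2) with hK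
  have hc0 : 0 < c := by positivity
  have hK0 : 0 < K := by positivity
  have h1 := norm_fresnel_le_const hs.le
  have h2 : ‖fresnel s‖ ≤ c * K * s⁻¹ := by
    refine (norm_fresnel_le_inv hs).trans ?_
    rw [one_div, mul_inv, ← one_div]
    gcongr
    exact sqrt_pi_bound
  have hn := norm_nonneg (fresnel s)
  obtain ⟨hδ1, hδ2⟩ := hδ
  calc ‖fresnel s‖ = ‖fresnel s‖ ^ (2 - 2 * δ) * ‖fresnel s‖ ^ (2 * δ - 1) := by
        rw [← Real.rpow_add' hn (by norm_num)]
        norm_num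
    _ ≤ c ^ (2 - 2 * δ) * (c * K * s⁻¹) ^ (2 * δ - 1) := by
        gcongr <;> linarith
    _ = (c ^ (2 - 2 * δ) * c ^ (2 * δ - 1)) * K ^ (2 * δ - 1) * (s⁻¹) ^ (2 * δ - 1) := by
        rw [Real.mul_rpow (by positivity) (by positivity), Real.mul_rpow hc0.le hK0.le]
        ring
    _ = constL δ * s ^ (1 - 2 * δ) := by
        rw [← Real.rpow_add hc0, Real.inv_rpow hs.le, ← Real.rpow_neg hs.le, constL, ← hc, ← hK,
          show 2 - 2 * δ + (2 * δ - 1) = 1 by ring, Real.rpow_one,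
          show -(2 * δ - 1) = 1 - 2 * δ by ring]

/-! ### Stationary phase -/

lemma le_of_hasDerivAt_le {F G F' G' : ℝ → ℝ} {c : ℝ} (hF : ∀ q, HasDerivAt F (F' q) q)
    (hG : ∀ q, HasDerivAt G (G' q) q) (h0 : F 0 = G 0) (h : ∀ q ∈ Icc 0 c, F' q ≤ G' q)
    {q : ℝ} (hq : q ∈ Icc 0 c) : F q ≤ G q := by
  have hmono : MonotoneOn (fun q => G q - F q) (Icc 0 c) := by
    refine monotoneOn_of_hasDerivWithinAt_nonneg (f' := fun q => G' q - F' q) (convex_Icc 0 c)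
      (fun x _ => ((hG x).sub (hF x)).continuousAt.continuousWithinAt)
      (fun x _ => ((hG x).sub (hF x)).hasDerivWithinAt) fun x hx => ?_
    have := h x (interior_subset hx)
    linarith
  have := hmono ⟨le_rfl, hq.1.trans hq.2⟩ hq hq.1
  simp only [h0, sub_self] at this
  linarith

/-- `h` is a phase function on `[0,c]` with the nondegenerate critical point `0` and critical value
`0`, with its first three derivatives and bounds for the last two. -/
structure IsPhase (h h₁ h₂ h₃ : ℝ → ℝ) (m M₂ M₃ c : ℝ) : Prop where
  d₁ : ∀ q, HasDerivAt h (h₁ q) q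
  d₂ : ∀ q, HasDerivAt h₁ (h₂ q) q
  d₃ : ∀ q, HasDerivAt h₂ (h₃ q) q
  zero : h 0 = 0
  zero₁ : h₁ 0 = 0
  pos : 0 < m
  lower : ∀ q ∈ Icc 0 c, m ≤ h₂ q
  upper : ∀ q ∈ Icc 0 c, h₂ q ≤ M₂
  upper₃ : ∀ q ∈ Icc 0 c, |h₃ q| ≤ M₃

namespace IsPhase

variable {h h₁ h₂ h₃ : ℝ → ℝ} {m M₂ M₃ c : ℝ}

lemma deriv_lower (H : IsPhase h h₁ h₂ h₃ m M₂ M₃ c) {q : ℝ} (hq : q ∈ Icc 0 c) :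
    m * q ≤ h₁ q :=
  le_of_hasDerivAt_le (F' := fun _ => m) (fun q => by simpa using (hasDerivAt_id q).const_mul m)
    H.d₂ (by simp [H.zero₁]) H.lower hq

lemma deriv_upper (H : IsPhase h h₁ h₂ h₃ m M₂ M₃ c) {q : ℝ} (hq : q ∈ Icc 0 c) :
    h₁ q ≤ M₂ * q :=
  le_of_hasDerivAt_le (G' := fun _ => M₂) H.d₂
    (fun q => by simpa using (hasDerivAt_id q).const_mul M₂) (by simp [H.zero₁]) H.upper hq

lemma hasDerivAt_const_mul_pow (a : ℝ) (n : ℕ) (q : ℝ) :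
    HasDerivAt (fun q : ℝ => a * q ^ n) (a * (n * q ^ (n - 1))) q :=
  (hasDerivAt_pow n q).const_mul a

lemma val_lower (H : IsPhase h h₁ h₂ h₃ m M₂ M₃ c) {q : ℝ} (hq : q ∈ Icc 0 c) :
    m / 2 * q ^ 2 ≤ h q := by
  refine le_of_hasDerivAt_le (hasDerivAt_const_mul_pow (m / 2) 2) H.d₁ (by simp [H.zero])
    (fun q hq => ?_) hq
  have := H.deriv_lower hq
  norm_num
  linarith

lemma val_upper (H : IsPhase h h₁ h₂ h₃ m M₂ M₃ c) {q : ℝ} (hq : q ∈ Icc 0 c) :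
    h q ≤ M₂ / 2 * q ^ 2 := by
  refine le_of_hasDerivAt_le H.d₁ (hasDerivAt_const_mul_pow (M₂ / 2) 2) (by simp [H.zero])
    (fun q hq => ?_) hq
  have := H.deriv_upper hq
  norm_num
  linarith

/-- The quantity `h'² - 2hh''` measures the failure of `h` to be a pure quadratic. The terms
`2h'h''` cancel in its derivative, leaving only `h'''` times the second-order quantity `h`, so the
defect is of third order at the critical point. -/
lemma defect_hasDerivAt (H : IsPhase h h₁ h₂ h₃ m M₂ M₃ c) (q : ℝ) :
    HasDerivAt (fun q => h₁ q ^ 2 - 2 * h q * h₂ q) (-2 * h q * h₃ q) q := by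
  have := ((H.d₂ q).pow 2).sub (((H.d₁ q).const_mul 2).mul (H.d₃ q))
  refine this.congr_deriv ?_
  norm_num

lemma defect_le (H : IsPhase h h₁ h₂ h₃ m M₂ M₃ c) {q : ℝ} (hq : q ∈ Icc 0 c) :
    |h₁ q ^ 2 - 2 * h q * h₂ q| ≤ M₂ * M₃ / 3 * q ^ 3 := by
  have hb : ∀ q ∈ Icc 0 c, |-2 * h q * h₃ q| ≤ M₂ * M₃ * q ^ 2 := by
    intro q hq
    have h1 := H.val_upper hq
    have h0 : 0 ≤ h q := le_trans (by have := H.pos; positivity) (H.val_lower hq)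
    have h3 := H.upper₃ q hq
    rw [abs_mul, abs_mul, abs_of_nonneg h0, abs_neg, abs_two]
    calc 2 * h q * |h₃ q| ≤ 2 * (M₂ / 2 * q ^ 2) * M₃ := by gcongr; linarith
      _ = _ := by ring
  have key : ∀ q ∈ Icc 0 c, M₂ * M₃ * q ^ 2 = M₂ * M₃ / 3 * ((3 : ℕ) * q ^ (3 - 1)) := by
    intro q _; push_cast; ring
  rw [abs_le']
  constructor
  · refine le_of_hasDerivAt_le H.defect_hasDerivAt (hasDerivAt_const_mul_pow (M₂ * M₃ / 3) 3)
      (by simp [H.zero, H.zero₁]) (fun q hq => ?_) hq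
    rw [← key q hq]
    exact (le_abs_self _).trans (hb q hq)
  · refine le_of_hasDerivAt_le (fun q => (H.defect_hasDerivAt q).neg)
      (hasDerivAt_const_mul_pow (M₂ * M₃ / 3) 3)
      (by simp [H.zero, H.zero₁]) (fun q hq => ?_) hq
    rw [← key q hq]
    exact (neg_le_abs _).trans (hb q hq)

lemma deriv_pos (H : IsPhase h h₁ h₂ h₃ m M₂ M₃ c) {q : ℝ} (hq : q ∈ Ioc 0 c) : 0 < h₁ q :=
  lt_of_lt_of_le (mul_pos H.pos hq.1) (H.deriv_lower ⟨hq.1.le, hq.2⟩)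

lemma val_pos (H : IsPhase h h₁ h₂ h₃ m M₂ M₃ c) {q : ℝ} (hq : q ∈ Ioc 0 c) : 0 < h q :=
  lt_of_lt_of_le (by have := H.pos; have := hq.1; positivity) (H.val_lower ⟨hq.1.le, hq.2⟩)

lemma sqrt_lower (H : IsPhase h h₁ h₂ h₃ m M₂ M₃ c) {q : ℝ} (hq : q ∈ Icc 0 c) :
    Real.sqrt (m / 2) * q ≤ Real.sqrt (h q) := by
  refine Real.le_sqrt_of_sq_le ?_
  rw [mul_pow, Real.sq_sqrt (by have := H.pos; positivity)]
  exact H.val_lower hq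

lemma sqrt_upper (H : IsPhase h h₁ h₂ h₃ m M₂ M₃ c) {q : ℝ} (hq : q ∈ Icc 0 c) :
    Real.sqrt (h q) ≤ Real.sqrt (M₂ / 2) * q := by
  have hM : 0 ≤ M₂ := (H.pos.le.trans (H.lower q hq)).trans (H.upper q hq)
  refine Real.sqrt_le_iff.2 ⟨mul_nonneg (Real.sqrt_nonneg _) hq.1, ?_⟩
  rw [mul_pow, Real.sq_sqrt (by positivity)]
  exact H.val_upper hq

end IsPhase

/-- `1 / (√h)'`, extended continuously to the critical point. -/
def amplitude (h h₁ h₂ : ℝ → ℝ) (q : ℝ) : ℝ :=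
  Real.sqrt (2 / h₂ q * (1 - (h₁ q ^ 2 - 2 * h q * h₂ q) / h₁ q ^ 2))

/-- The derivative of `amplitude`. -/
def amplitudeDeriv (h h₁ h₂ : ℝ → ℝ) (q : ℝ) : ℝ :=
  (h₁ q ^ 2 - 2 * h q * h₂ q) / (Real.sqrt (h q) * h₁ q ^ 2)

namespace IsPhase

variable {h h₁ h₂ h₃ : ℝ → ℝ} {m M₂ M₃ c : ℝ}

/-- Division by zero makes the defect quotient `0` at the critical point, which is also its limit.
This is why `amplitude` is written with the defect and not as `2√h/h'`. -/
lemma amplitude_zero (H : IsPhase h h₁ h₂ h₃ m M₂ M₃ c) :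
    amplitude h h₁ h₂ 0 = Real.sqrt (2 / h₂ 0) := by
  simp [amplitude, H.zero₁]

lemma amplitude_eq (H : IsPhase h h₁ h₂ h₃ m M₂ M₃ c) {q : ℝ} (hq : q ∈ Ioc 0 c) :
    amplitude h h₁ h₂ q = 2 * Real.sqrt (h q) / h₁ q := by
  have h1 := H.deriv_pos hq
  have h2 : 0 < h₂ q := H.pos.trans_le (H.lower q ⟨hq.1.le, hq.2⟩)
  have h0 := H.val_pos hq
  rw [amplitude]
  rw [Real.sqrt_eq_iff_mul_self_eq_of_pos (by positivity)]
  have e := Real.mul_self_sqrt h0.le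
  field_simp
  rw [Real.sq_sqrt h0.le]
  ring

lemma amplitude_continuousOn (H : IsPhase h h₁ h₂ h₃ m M₂ M₃ c) :
    ContinuousOn (amplitude h h₁ h₂) (Icc 0 c) := by
  have c0 : Continuous h := continuous_iff_continuousAt.2 fun q => (H.d₁ q).continuousAt
  have c1 : Continuous h₁ := continuous_iff_continuousAt.2 fun q => (H.d₂ q).continuousAt
  have c2 : Continuous h₂ := continuous_iff_continuousAt.2 fun q => (H.d₃ q).continuousAt
  unfold amplitude
  apply ContinuousOn.sqrt
  refine ContinuousOn.mul (continuousOn_const.div c2.continuousOn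
    fun q hq => (H.pos.trans_le (H.lower q hq)).ne') (continuousOn_const.sub ?_)
  intro q hq
  rcases eq_or_lt_of_le hq.1 with h0 | h0
  · subst h0
    unfold ContinuousWithinAt
    simp only [H.zero₁, H.zero, ne_eq, OfNat.ofNat_ne_zero, not_false_eq_true, zero_pow, mul_zero,
      zero_mul, sub_zero, div_zero]
    -- A defect of order `q³` over `h'² ≥ m²q²` is of order `q`.
    apply squeeze_zero_norm' (a := fun q => M₂ * M₃ / 3 / m ^ 2 * q)
    · filter_upwards [self_mem_nhdsWithin] with q hq
      rcases eq_or_lt_of_le hq.1 with h0 | h0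
      · subst h0; simp [H.zero₁]
      have hd := H.defect_le hq
      have h1 := H.deriv_lower hq
      have hm := H.pos
      rw [norm_div, Real.norm_eq_abs, Real.norm_of_nonneg (by positivity)]
      calc _ ≤ (M₂ * M₃ / 3 * q ^ 3) / (m * q) ^ 2 := by
            gcongr
            exact (abs_nonneg _).trans hd
        _ = _ := by field_simp
    · have : Continuous fun q : ℝ => M₂ * M₃ / 3 / m ^ 2 * q := by fun_prop
      simpa using (this.tendsto 0).mono_left nhdsWithin_le_nhds
  · have := (H.deriv_pos ⟨h0, hq.2⟩).ne'
    apply ContinuousAt.continuousWithinAt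
    apply ContinuousAt.div
    · fun_prop
    · fun_prop
    · positivity

lemma amplitude_hasDerivAt (H : IsPhase h h₁ h₂ h₃ m M₂ M₃ c) {q : ℝ} (hq : q ∈ Ioo 0 c) :
    HasDerivAt (amplitude h h₁ h₂) (amplitudeDeriv h h₁ h₂ q) q := by
  have hq' : q ∈ Ioc 0 c := ⟨hq.1, hq.2.le⟩
  have h1 := H.deriv_pos hq'
  have h0 := H.val_pos hq'
  have hd := (((H.d₁ q).sqrt h0.ne').const_mul 2).div (H.d₂ q) h1.ne'
  have he : amplitude h h₁ h₂ =ᶠ[nhds q] fun q => 2 * Real.sqrt (h q) / h₁ q := by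
    filter_upwards [Ioo_mem_nhds hq.1 hq.2] with x hx
    exact H.amplitude_eq ⟨hx.1, hx.2.le⟩
  refine (hd.congr_of_eventuallyEq he).congr_deriv ?_
  have hs : 0 < Real.sqrt (h q) := Real.sqrt_pos.2 h0
  rw [amplitudeDeriv]
  field_simp
  rw [Real.sq_sqrt h0.le]
  ring

lemma amplitude_le (H : IsPhase h h₁ h₂ h₃ m M₂ M₃ c) {q : ℝ} (hq : q ∈ Ioc 0 c) :
    |amplitude h h₁ h₂ q| ≤ 2 * Real.sqrt (M₂ / 2) / m := by
  have hq' : q ∈ Icc 0 c := ⟨hq.1.le, hq.2⟩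
  have h1 := H.deriv_pos hq
  have hm := H.pos
  have hq0 := hq.1
  rw [H.amplitude_eq hq, abs_of_nonneg (by positivity)]
  calc 2 * Real.sqrt (h q) / h₁ q ≤ 2 * (Real.sqrt (M₂ / 2) * q) / (m * q) := by
        gcongr
        · exact H.sqrt_upper hq'
        · exact H.deriv_lower hq'
    _ = _ := by field_simp

/-- The cubic order of the defect exactly matches the cubic denominator `√h·h'²`, so the bound does
not degenerate at the critical point. -/
lemma amplitudeDeriv_le (H : IsPhase h h₁ h₂ h₃ m M₂ M₃ c) {q : ℝ} (hq : q ∈ Ioc 0 c) :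
    |amplitudeDeriv h h₁ h₂ q| ≤ M₂ * M₃ / 3 / (Real.sqrt (m / 2) * m ^ 2) := by
  have hq' : q ∈ Icc 0 c := ⟨hq.1.le, hq.2⟩
  have h1 := H.deriv_pos hq
  have hm := H.pos
  have hq0 := hq.1
  have hs : 0 < Real.sqrt (m / 2) := Real.sqrt_pos.2 (by positivity)
  have hd := H.defect_le hq'
  rw [amplitudeDeriv, abs_div, abs_of_nonneg (a := Real.sqrt (h q) * h₁ q ^ 2) (by positivity)]
  calc _ ≤ (M₂ * M₃ / 3 * q ^ 3) / ((Real.sqrt (m / 2) * q) * (m * q) ^ 2) := by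
        gcongr
        · exact (abs_nonneg _).trans hd
        · exact H.sqrt_lower hq'
        · exact H.deriv_lower hq'
    _ = _ := by field_simp

lemma norm_fresnel_sqrt_le (H : IsPhase h h₁ h₂ h₃ m M₂ M₃ c) {δ q : ℝ}
    (hδ : δ ∈ Ioo (1 / 2 : ℝ) (3 / 4)) (hq : q ∈ Ioc 0 c) :
    ‖fresnel (Real.sqrt (h q))‖ ≤
      constL δ * Real.sqrt (m / 2) ^ (1 - 2 * δ) * q ^ (1 - 2 * δ) := by
  have hs : 0 < Real.sqrt (m / 2) := Real.sqrt_pos.2 (by have := H.pos; positivity)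
  refine (norm_fresnel_le hδ (Real.sqrt_pos.2 (H.val_pos hq))).trans ?_
  rw [mul_assoc, ← Real.mul_rpow hs.le hq.1.le]
  refine mul_le_mul_of_nonneg_left ?_ (constL_pos δ).le
  exact Real.rpow_le_rpow_of_nonpos (mul_pos hs hq.1) (H.sqrt_lower ⟨hq.1.le, hq.2⟩)
    (by linarith [hδ.1])

/-- The stationary phase estimate with the critical point at the left end of the interval. -/
theorem norm_integral_sub_le (H : IsPhase h h₁ h₂ h₃ m M₂ M₃ c) (hc : 0 ≤ c) {U U' : ℝ → ℂ}
    (hU : ∀ q, HasDerivAt U (U' q) q) (hU' : Continuous U') (hUc : U c = 0) {B : ℝ}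
    (hB : ∀ q, ‖U q‖ ≤ B) {δ : ℝ} (hδ : δ ∈ Ioo (1 / 2 : ℝ) (3 / 4)) :
    ‖(∫ q in (0 : ℝ)..c, U q * Complex.exp (-(Complex.I * h q)))
        - U 0 * (Real.sqrt (2 / h₂ 0) : ℂ) * ((Real.sqrt 2 : ℂ) / 2 * (1 - Complex.I))
          * ((Real.sqrt Real.pi / 2 : ℝ) : ℂ)‖ ≤
      constL δ * Real.sqrt (m / 2) ^ (1 - 2 * δ) *
        (2 * Real.sqrt (M₂ / 2) / m * (∫ q in (0 : ℝ)..c, ‖U' q‖ * q ^ (1 - 2 * δ))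
          + B * (M₂ * M₃ / 3 / (Real.sqrt (m / 2) * m ^ 2)) * (c ^ (2 - 2 * δ) / (2 - 2 * δ))) := by
  have c0 : Continuous h := continuous_iff_continuousAt.2 fun q => (H.d₁ q).continuousAt
  have c1 : Continuous h₁ := continuous_iff_continuousAt.2 fun q => (H.d₂ q).continuousAt
  have c2 : Continuous h₂ := continuous_iff_continuousAt.2 fun q => (H.d₃ q).continuousAt
  have cU : Continuous U := continuous_iff_continuousAt.2 fun q => (hU q).continuousAt
  have cG : Continuous fresnel :=
    continuous_iff_continuousAt.2 fun q => (hasDerivAt_fresnel q).continuousAt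
  set K := constL δ * Real.sqrt (m / 2) ^ (1 - 2 * δ) with hK
  set K₁ := 2 * Real.sqrt (M₂ / 2) / m with hK₁
  set K₂ := M₂ * M₃ / 3 / (Real.sqrt (m / 2) * m ^ 2) with hK₂
  set A := amplitude h h₁ h₂ with hA
  set A' := amplitudeDeriv h h₁ h₂ with hA'
  set R : ℝ → ℂ := fun q => (U' q * A q + U q * A' q) * fresnel (Real.sqrt (h q)) with hR
  set W : ℝ → ℂ := fun q => U q * A q * fresnel (Real.sqrt (h q)) with hW
  have hK0 : 0 ≤ K := mul_nonneg (constL_pos δ).le (Real.rpow_nonneg (Real.sqrt_nonneg _) _)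
  -- The singularity at `0` is integrable because `1-2δ > -1`.
  have hrpow : IntervalIntegrable (fun q : ℝ => q ^ (1 - 2 * δ)) volume 0 c :=
    intervalIntegral.intervalIntegrable_rpow' (by linarith [hδ.2])
  have hbi1 : IntervalIntegrable (fun q : ℝ => ‖U' q‖ * q ^ (1 - 2 * δ)) volume 0 c :=
    hrpow.continuousOn_mul hU'.norm.continuousOn
  have hbi : IntervalIntegrable (fun q : ℝ => K * (K₁ * (‖U' q‖ * q ^ (1 - 2 * δ))
      + B * K₂ * q ^ (1 - 2 * δ))) volume 0 c :=
    ((hbi1.const_mul _).add (hrpow.const_mul _)).const_mul _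
  have hRle : ∀ q ∈ Ioc 0 c, ‖R q‖ ≤
      K * (K₁ * (‖U' q‖ * q ^ (1 - 2 * δ)) + B * K₂ * q ^ (1 - 2 * δ)) := by
    intro q hq
    have hq0 : 0 ≤ q ^ (1 - 2 * δ) := Real.rpow_nonneg hq.1.le _
    have hB0 : 0 ≤ B := (norm_nonneg _).trans (hB 0)
    calc ‖R q‖ = ‖U' q * A q + U q * A' q‖ * ‖fresnel (Real.sqrt (h q))‖ := norm_mul _ _
      _ ≤ (‖U' q‖ * K₁ + B * K₂) * (K * q ^ (1 - 2 * δ)) := by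
          have hn : ‖U' q * A q + U q * A' q‖ ≤ ‖U' q‖ * K₁ + B * K₂ := by
            refine (norm_add_le _ _).trans ?_
            rw [norm_mul, norm_mul, Complex.norm_real, Complex.norm_real, Real.norm_eq_abs,
              Real.norm_eq_abs]
            gcongr
            · exact H.amplitude_le hq
            · exact hB q
            · exact H.amplitudeDeriv_le hq
          exact mul_le_mul hn (H.norm_fresnel_sqrt_le hδ hq) (norm_nonneg _)
            ((norm_nonneg _).trans hn)
      _ = _ := by ring
  have hcontA : ContinuousOn A (Icc 0 c) := H.amplitude_continuousOn
  have hcontA' : ContinuousOn A' (Ioc 0 c) := by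
    refine ContinuousOn.div (by fun_prop) (by fun_prop) fun q hq => ?_
    have := H.deriv_pos hq
    have := Real.sqrt_pos.2 (H.val_pos hq)
    positivity
  have hcontR : ContinuousOn R (Ioc 0 c) := by
    refine ContinuousOn.mul (ContinuousOn.add ?_ ?_) ?_
    · exact hU'.continuousOn.mul
        (Complex.continuous_ofReal.comp_continuousOn (hcontA.mono Ioc_subset_Icc_self))
    · exact cU.continuousOn.mul (Complex.continuous_ofReal.comp_continuousOn hcontA')
    · exact (cG.comp c0.sqrt).continuousOn
  have hRi : IntervalIntegrable R volume 0 c := by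
    rw [intervalIntegrable_iff_integrableOn_Ioc_of_le hc] at hbi ⊢
    refine Integrable.mono' hbi (hcontR.aestronglyMeasurable measurableSet_Ioc) ?_
    filter_upwards [ae_restrict_mem measurableSet_Ioc] with q hq using hRle q hq
  have hWc : ContinuousOn W (Icc 0 c) :=
    (cU.continuousOn.mul (Complex.continuous_ofReal.comp_continuousOn hcontA)).mul
      (cG.comp c0.sqrt).continuousOn
  have hUe : Continuous fun q : ℝ => U q * Complex.exp (-(Complex.I * h q)) := by fun_prop
  have hWd : ∀ q ∈ Ioo 0 c,
      HasDerivAt W (U q * Complex.exp (-(Complex.I * h q)) + R q) q := by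
    intro q hq
    have hq' : q ∈ Ioc 0 c := ⟨hq.1, hq.2.le⟩
    have hp := H.val_pos hq'
    have hs := Real.sqrt_pos.2 hp
    have h1 := H.deriv_pos hq'
    have dA := (H.amplitude_hasDerivAt hq).ofReal_comp
    have dG := (hasDerivAt_fresnel (Real.sqrt (h q))).scomp q ((H.d₁ q).sqrt hp.ne')
    refine (((hU q).mul dA).mul dG).congr_deriv ?_
    -- The amplitude is the reciprocal of `(√h)'`, so the chain rule factor of `fresnel ∘ √h`
    -- disappears and `W` is a primitive of the integrand up to `R`.
    have e1 : A q * (h₁ q / (2 * Real.sqrt (h q))) = 1 := by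
      rw [hA, H.amplitude_eq hq']
      field_simp
    have e1' : (A q : ℂ) * ((h₁ q / (2 * Real.sqrt (h q)) : ℝ) : ℂ) = 1 := by
      rw [← Complex.ofReal_mul, e1, Complex.ofReal_one]
    have e2 : ((Real.sqrt (h q) : ℝ) : ℂ) ^ 2 = h q := by
      rw [← Complex.ofReal_pow, Real.sq_sqrt hp.le]
    simp only [Complex.real_smul, hR, Pi.mul_apply, Function.comp_apply, e2, ← hA, ← hA']
    linear_combination (U q * Complex.exp (-(Complex.I * h q))) * e1'
  -- Only continuity of `W` is needed at the endpoints, where `√h` may fail to be differentiable.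
  -- The boundary term at `c` vanishes with `U`, and the one at `0` is the leading term.
  have hftc := intervalIntegral.integral_eq_sub_of_hasDerivAt_of_le hc hWc hWd
    ((hUe.intervalIntegrable 0 c).add hRi)
  rw [intervalIntegral.integral_add (hUe.intervalIntegrable 0 c) hRi] at hftc
  have hW0 : W 0 = -(U 0 * (Real.sqrt (2 / h₂ 0) : ℂ) *
      ((Real.sqrt 2 : ℂ) / 2 * (1 - Complex.I)) * ((Real.sqrt Real.pi / 2 : ℝ) : ℂ)) := by
    simp only [hW, hA, H.amplitude_zero, H.zero, Real.sqrt_zero, fresnel_zero]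
    ring
  have hWc0 : W c = 0 := by simp [hW, hUc]
  rw [hW0, hWc0] at hftc
  have hfin : (∫ q in (0 : ℝ)..c, U q * Complex.exp (-(Complex.I * h q)))
        - U 0 * (Real.sqrt (2 / h₂ 0) : ℂ) * ((Real.sqrt 2 : ℂ) / 2 * (1 - Complex.I))
          * ((Real.sqrt Real.pi / 2 : ℝ) : ℂ) = -∫ q in (0 : ℝ)..c, R q := by
    linear_combination hftc
  rw [hfin, norm_neg]
  refine (intervalIntegral.norm_integral_le_of_norm_le hc
    (.of_forall fun q hq => hRle q hq) hbi).trans_eq ?_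
  rw [intervalIntegral.integral_const_mul, intervalIntegral.integral_add (hbi1.const_mul _)
    (hrpow.const_mul _), intervalIntegral.integral_const_mul, intervalIntegral.integral_const_mul,
    integral_rpow (Or.inl (by linarith [hδ.2]))]
  have hz : (1 : ℝ) - 2 * δ + 1 = 2 - 2 * δ := by ring
  rw [hz, Real.zero_rpow (by linarith [hδ.2]), sub_zero]

end IsPhase

/-- Cauchy–Schwarz. The squared weight `q^{2-4δ}` is integrable at `0` because `δ < 3/4`; this is
where the upper limit on `δ` comes from. -/
lemma integral_norm_mul_rpow_le {U' : ℝ → ℂ} (hU' : Continuous U')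
    (hE : Integrable (fun q => ‖U' q‖ ^ 2)) {c ℓ δ : ℝ} (hc : 0 ≤ c) (hcl : c ≤ ℓ)
    (hδ : δ ∈ Ioo (1 / 2 : ℝ) (3 / 4)) :
    ∫ q in (0 : ℝ)..c, ‖U' q‖ * q ^ (1 - 2 * δ) ≤
      Real.sqrt (∫ q, ‖U' q‖ ^ 2) * Real.sqrt (ℓ ^ (3 - 4 * δ) / (3 - 4 * δ)) := by
  have h3 : 0 < 3 - 4 * δ := by linarith [hδ.2]
  have hsq : ∀ q ∈ Ioc 0 c, (q ^ (1 - 2 * δ)) ^ 2 = q ^ (2 - 4 * δ) := by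
    intro q hq
    rw [← Real.rpow_natCast, ← Real.rpow_mul hq.1.le]
    congr 1
    push_cast
    ring
  have hri : IntegrableOn (fun q : ℝ => q ^ (2 - 4 * δ)) (Ioc 0 c) :=
    (intervalIntegrable_iff_integrableOn_Ioc_of_le hc).1
      (intervalIntegral.intervalIntegrable_rpow' (by linarith))
  have hm1 : MemLp (fun q => ‖U' q‖) 2 (volume.restrict (Ioc 0 c)) :=
    (memLp_two_iff_integrable_sq hU'.norm.aestronglyMeasurable).2 hE.integrableOn
  have hm2 : MemLp (fun q : ℝ => q ^ (1 - 2 * δ)) 2 (volume.restrict (Ioc 0 c)) := by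
    refine (memLp_two_iff_integrable_sq (Measurable.aestronglyMeasurable (by fun_prop))).2 ?_
    exact IntegrableOn.congr_fun hri (fun q hq => (hsq q hq).symm) measurableSet_Ioc
  have key := integral_mul_le_Lp_mul_Lq_of_nonneg (μ := volume.restrict (Ioc 0 c))
    Real.HolderConjugate.two_two (f := fun q => ‖U' q‖) (g := fun q : ℝ => q ^ (1 - 2 * δ))
    (.of_forall fun q => norm_nonneg _)
    (by filter_upwards [ae_restrict_mem measurableSet_Ioc] with q hq using
        Real.rpow_nonneg hq.1.le _)
    (by simpa using hm1) (by simpa using hm2)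
  rw [intervalIntegral.integral_of_le hc]
  refine key.trans ?_
  rw [← Real.sqrt_eq_rpow, ← Real.sqrt_eq_rpow]
  simp only [Real.rpow_two]
  apply mul_le_mul
  · exact Real.sqrt_le_sqrt (setIntegral_le_integral hE (.of_forall fun q => by positivity))
  · apply Real.sqrt_le_sqrt
    rw [setIntegral_congr_fun measurableSet_Ioc hsq, ← intervalIntegral.integral_of_le hc,
      integral_rpow (Or.inl (by linarith)), show 2 - 4 * δ + 1 = 3 - 4 * δ by ring,
      Real.zero_rpow h3.ne', sub_zero]
    gcongr
  · positivity
  · positivity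

/-- The right-hand side of the stationary phase estimate on one side of the critical point, for an
interval of length at most `ℓ`, and an amplitude bounded by `B` with derivative of squared
`L²`-norm `E`. -/
def phaseBound (δ m M₂ M₃ ℓ E B : ℝ) : ℝ :=
  constL δ * Real.sqrt (m / 2) ^ (1 - 2 * δ) *
    (2 * Real.sqrt (M₂ / 2) / m * (Real.sqrt E * Real.sqrt (ℓ ^ (3 - 4 * δ) / (3 - 4 * δ)))
      + B * (M₂ * M₃ / 3 / (Real.sqrt (m / 2) * m ^ 2)) * (ℓ ^ (2 - 2 * δ) / (2 - 2 * δ)))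

lemma IsPhase.norm_integral_sub_le_phaseBound {h h₁ h₂ h₃ : ℝ → ℝ} {m M₂ M₃ c ℓ : ℝ}
    (H : IsPhase h h₁ h₂ h₃ m M₂ M₃ c) (hc : 0 ≤ c) (hcl : c ≤ ℓ) {U U' : ℝ → ℂ}
    (hU : ∀ q, HasDerivAt U (U' q) q) (hU' : Continuous U')
    (hE : Integrable (fun q => ‖U' q‖ ^ 2)) (hUc : U c = 0) {B : ℝ}
    (hB : ∀ q, ‖U q‖ ≤ B) {δ : ℝ} (hδ : δ ∈ Ioo (1 / 2 : ℝ) (3 / 4)) :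
    ‖(∫ q in (0 : ℝ)..c, U q * Complex.exp (-(Complex.I * h q)))
        - U 0 * (Real.sqrt (2 / h₂ 0) : ℂ) * ((Real.sqrt 2 : ℂ) / 2 * (1 - Complex.I))
          * ((Real.sqrt Real.pi / 2 : ℝ) : ℂ)‖ ≤
      phaseBound δ m M₂ M₃ ℓ (∫ q, ‖U' q‖ ^ 2) B := by
  refine (H.norm_integral_sub_le hc hU hU' hUc hB hδ).trans ?_
  have h0 : (0 : ℝ) ∈ Icc 0 c := ⟨le_rfl, hc⟩
  have hm := H.pos
  have hM : 0 ≤ M₂ := (H.pos.le.trans (H.lower 0 h0)).trans (H.upper 0 h0)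
  have hM3 : 0 ≤ M₃ := (abs_nonneg _).trans (H.upper₃ 0 h0)
  have hB0 : 0 ≤ B := (norm_nonneg _).trans (hB 0)
  have hL := (constL_pos δ).le
  have := integral_norm_mul_rpow_le hU' hE hc hcl hδ
  have h2 : 0 < 2 - 2 * δ := by linarith [hδ.2]
  unfold phaseBound
  gcongr

/-- The stationary phase estimate for a critical point anywhere in the interval. -/
theorem norm_integral_sub_le_two_mul_phaseBound {g g₁ g₂ g₃ : ℝ → ℝ} {m M₂ M₃ a b p₀ : ℝ}
    (d₁ : ∀ q, HasDerivAt g (g₁ q) q) (d₂ : ∀ q, HasDerivAt g₁ (g₂ q) q)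
    (d₃ : ∀ q, HasDerivAt g₂ (g₃ q) q) (hp₀ : p₀ ∈ Icc a b) (hcrit : g₁ p₀ = 0) (hm : 0 < m)
    (hlower : ∀ q ∈ Icc a b, m ≤ g₂ q) (hupper : ∀ q ∈ Icc a b, g₂ q ≤ M₂)
    (hupper₃ : ∀ q ∈ Icc a b, |g₃ q| ≤ M₃) {U U' : ℝ → ℂ}
    (hU : ∀ q, HasDerivAt U (U' q) q) (hU' : Continuous U')
    (hE : Integrable (fun q => ‖U' q‖ ^ 2)) (hUa : U a = 0) (hUb : U b = 0) {B : ℝ}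
    (hB : ∀ q, ‖U q‖ ≤ B) {δ : ℝ} (hδ : δ ∈ Ioo (1 / 2 : ℝ) (3 / 4)) :
    ‖(∫ q in a..b, U q * Complex.exp (-(Complex.I * g q)))
        - Complex.exp (-(Complex.I * g p₀)) * (U p₀ * (Real.sqrt (2 / g₂ p₀) : ℂ)
          * ((Real.sqrt 2 : ℂ) / 2 * (1 - Complex.I)) * ((Real.sqrt Real.pi : ℝ) : ℂ))‖ ≤
      2 * phaseBound δ m M₂ M₃ (b - a) (∫ q, ‖U' q‖ ^ 2) B := by
  have Hr : IsPhase (fun q => g (p₀ + q) - g p₀) (fun q => g₁ (p₀ + q)) (fun q => g₂ (p₀ + q))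
      (fun q => g₃ (p₀ + q)) m M₂ M₃ (b - p₀) := by
    have hmem : ∀ q ∈ Icc 0 (b - p₀), p₀ + q ∈ Icc a b := fun q hq =>
      ⟨by linarith [hq.1, hp₀.1], by linarith [hq.2]⟩
    exact ⟨fun q => ((d₁ _).comp_const_add p₀ q).sub_const _, fun q => (d₂ _).comp_const_add p₀ q,
      fun q => (d₃ _).comp_const_add p₀ q, by simp, by simp [hcrit], hm,
      fun q hq => hlower _ (hmem q hq), fun q hq => hupper _ (hmem q hq),
      fun q hq => hupper₃ _ (hmem q hq)⟩
  -- Reflection at the critical point turns the left half into another phase with its critical point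
  -- at the left end; the odd derivatives change sign.
  have Hl : IsPhase (fun q => g (p₀ - q) - g p₀) (fun q => -g₁ (p₀ - q)) (fun q => g₂ (p₀ - q))
      (fun q => -g₃ (p₀ - q)) m M₂ M₃ (p₀ - a) := by
    have hmem : ∀ q ∈ Icc 0 (p₀ - a), p₀ - q ∈ Icc a b := fun q hq =>
      ⟨by linarith [hq.2], by linarith [hq.1, hp₀.2]⟩
    refine ⟨fun q => ((d₁ _).comp_const_sub p₀ q).sub_const _, fun q => ?_,
      fun q => (d₃ _).comp_const_sub p₀ q, by simp, by simp [hcrit], hm,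
      fun q hq => hlower _ (hmem q hq), fun q hq => hupper _ (hmem q hq),
      fun q hq => by rw [abs_neg]; exact hupper₃ _ (hmem q hq)⟩
    exact ((d₂ _).comp_const_sub p₀ q).neg.congr_deriv (neg_neg _)
  have hr := Hr.norm_integral_sub_le_phaseBound (ℓ := b - a) (by linarith [hp₀.2])
    (by linarith [hp₀.1]) (U := fun q => U (p₀ + q)) (U' := fun q => U' (p₀ + q))
    (fun q => (hU _).comp_const_add p₀ q) (by fun_prop) (hE.comp_add_left p₀) (by simp [hUb])
    (fun q => hB _) hδ
  have hl := Hl.norm_integral_sub_le_phaseBound (ℓ := b - a) (by linarith [hp₀.1])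
    (by linarith [hp₀.2]) (U := fun q => U (p₀ - q)) (U' := fun q => -U' (p₀ - q))
    (fun q => (hU _).comp_const_sub p₀ q) (by fun_prop)
    (by simpa using hE.comp_sub_left p₀) (by simp [hUa])
    (fun q => hB _) hδ
  simp only [norm_neg, add_zero, sub_zero] at hr hl
  rw [integral_add_left_eq_self (fun q => ‖U' q‖ ^ 2) p₀] at hr
  rw [integral_sub_left_eq_self (fun q => ‖U' q‖ ^ 2) volume p₀] at hl
  set F : ℝ → ℂ := fun q => U q * Complex.exp (-(Complex.I * ((g q - g p₀ : ℝ) : ℂ))) with hF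
  rw [intervalIntegral.integral_comp_add_left F, add_zero, add_sub_cancel] at hr
  rw [intervalIntegral.integral_comp_sub_left F, sub_zero, sub_sub_cancel] at hl
  have cg : Continuous g := continuous_iff_continuousAt.2 fun q => (d₁ q).continuousAt
  have cU : Continuous U := continuous_iff_continuousAt.2 fun q => (hU q).continuousAt
  have cF : Continuous F := by fun_prop
  have hsum : (∫ q in a..b, U q * Complex.exp (-(Complex.I * g q)))
      = Complex.exp (-(Complex.I * g p₀)) * ((∫ q in a..p₀, F q) + ∫ q in p₀..b, F q) := by
    rw [intervalIntegral.integral_add_adjacent_intervals (cF.intervalIntegrable _ _)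
      (cF.intervalIntegrable _ _), ← intervalIntegral.integral_const_mul]
    congr 1 with q
    rw [hF, mul_left_comm, ← Complex.exp_add]
    congr 2
    push_cast
    ring
  have hn : ‖Complex.exp (-(Complex.I * g p₀))‖ = 1 := by
    rw [Complex.norm_exp]; simp
  -- Each half contributes a half Gaussian `√π/2`, also when one half is degenerate because `p₀` is
  -- an endpoint.
  set Z : ℂ := U p₀ * (Real.sqrt (2 / g₂ p₀) : ℂ)
    * ((Real.sqrt 2 : ℂ) / 2 * (1 - Complex.I)) * ((Real.sqrt Real.pi / 2 : ℝ) : ℂ) with hZ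
  have hfin : (∫ q in a..b, U q * Complex.exp (-(Complex.I * g q)))
        - Complex.exp (-(Complex.I * g p₀)) * (U p₀ * (Real.sqrt (2 / g₂ p₀) : ℂ)
          * ((Real.sqrt 2 : ℂ) / 2 * (1 - Complex.I)) * ((Real.sqrt Real.pi : ℝ) : ℂ))
      = Complex.exp (-(Complex.I * g p₀)) *
        (((∫ q in a..p₀, F q) - Z) + ((∫ q in p₀..b, F q) - Z)) := by
    rw [hsum, hZ]
    push_cast
    ring
  rw [hfin, norm_mul, hn, one_mul, two_mul]
  exact (norm_add_le _ _).trans (add_le_add hl hr)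

/-! ### Nonstationary phase -/

/-- The nonstationary phase estimate: a single integration by parts. -/
theorem norm_integral_le_of_lower_bound {g g₁ g₂ : ℝ → ℝ} {μ c d : ℝ} (hcd : c ≤ d)
    (d₁ : ∀ q, HasDerivAt g (g₁ q) q) (d₂ : ∀ q, HasDerivAt g₁ (g₂ q) q) (cg₂ : Continuous g₂)
    (hμ : 0 < μ) (hlow : (∀ q ∈ Icc c d, μ ≤ g₁ q) ∨ ∀ q ∈ Icc c d, g₁ q ≤ -μ)
    (hpos : ∀ q ∈ Icc c d, 0 ≤ g₂ q)
    {U U' : ℝ → ℂ} (hU : ∀ q, HasDerivAt U (U' q) q) (hU' : Continuous U')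
    (hE : Integrable (fun q => ‖U' q‖ ^ 2)) (hUc : U c = 0) (hUd : U d = 0) {B : ℝ}
    (hB : ∀ q, ‖U q‖ ≤ B) :
    ‖∫ q in c..d, U q * Complex.exp (-(Complex.I * g q))‖ ≤
      (Real.sqrt (d - c) * Real.sqrt (∫ q, ‖U' q‖ ^ 2) + B) / μ := by
  have cg : Continuous g := continuous_iff_continuousAt.2 fun q => (d₁ q).continuousAt
  have cg₁ : Continuous g₁ := continuous_iff_continuousAt.2 fun q => (d₂ q).continuousAt
  have cU : Continuous U := continuous_iff_continuousAt.2 fun q => (hU q).continuousAt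
  have habs : ∀ q ∈ Icc c d, μ ≤ |g₁ q| := by
    intro q hq
    rcases hlow with h | h
    · exact (h q hq).trans (le_abs_self _)
    · exact le_trans (by linarith [h q hq]) (neg_le_abs _)
  have hne : ∀ q ∈ Icc c d, g₁ q ≠ 0 := fun q hq h0 => by
    have := habs q hq
    rw [h0, abs_zero] at this
    linarith
  have hneC : ∀ q ∈ Icc c d, (g₁ q : ℂ) ≠ 0 := fun q hq => by exact_mod_cast hne q hq
  have hB0 : 0 ≤ B := (norm_nonneg _).trans (hB 0)
  set e : ℝ → ℂ := fun q => Complex.exp (-(Complex.I * g q)) with he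
  have ce : Continuous e := by fun_prop
  have hen : ∀ q, ‖e q‖ = 1 := fun q => by rw [he, Complex.norm_exp]; simp
  set R : ℝ → ℂ := fun q => (U' q / g₁ q - U q * (g₂ q / (g₁ q : ℂ) ^ 2)) * (Complex.I * e q) with hR
  set W : ℝ → ℂ := fun q => U q / g₁ q * (Complex.I * e q) with hW
  have hWd : ∀ q ∈ Icc c d, HasDerivAt W (U q * e q + R q) q := by
    intro q hq
    have h0 := hneC q hq
    have h1 := (hU q).div (d₂ q).ofReal_comp h0
    have h2 := ((((d₁ q).ofReal_comp.const_mul Complex.I).neg).cexp).const_mul Complex.I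
    refine (h1.mul h2).congr_deriv ?_
    simp only [hR, Pi.neg_apply, Pi.div_apply]
    field_simp
    linear_combination (-(g₁ q : ℂ) ^ 2 * U q * e q) * Complex.I_sq
  have hcR : ContinuousOn R (Icc c d) := by
    refine ContinuousOn.mul (ContinuousOn.sub (ContinuousOn.div (by fun_prop) (by fun_prop) hneC)
      (ContinuousOn.mul (by fun_prop) (ContinuousOn.div (by fun_prop) (by fun_prop)
        fun q hq => pow_ne_zero 2 (hneC q hq)))) (by fun_prop)
  have hRi : IntervalIntegrable R volume c d := by
    apply ContinuousOn.intervalIntegrable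
    rwa [uIcc_of_le hcd]
  have hUi : IntervalIntegrable (fun q => U q * e q) volume c d :=
    (cU.mul ce).intervalIntegrable _ _
  have hftc := intervalIntegral.integral_eq_sub_of_hasDerivAt
    (fun q hq => hWd q (by rwa [uIcc_of_le hcd] at hq)) (hUi.add hRi)
  rw [intervalIntegral.integral_add hUi hRi] at hftc
  have hfin : ∫ q in c..d, U q * e q = -∫ q in c..d, R q := by
    have h1 : W c = 0 := by simp [hW, hUc]
    have h2 : W d = 0 := by simp [hW, hUd]
    rw [h1, h2] at hftc
    linear_combination hftc
  have hcq : ContinuousOn (fun q => g₂ q / g₁ q ^ 2) (Icc c d) :=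
    ContinuousOn.div (by fun_prop) (by fun_prop) fun q hq => pow_ne_zero 2 (hne q hq)
  have hqi : IntervalIntegrable (fun q => g₂ q / g₁ q ^ 2) volume c d := by
    apply ContinuousOn.intervalIntegrable
    rwa [uIcc_of_le hcd]
  have hU'i : IntervalIntegrable (fun q => ‖U' q‖) volume c d := hU'.norm.intervalIntegrable _ _
  have hle : ∀ q ∈ Ioc c d, ‖R q‖ ≤ μ⁻¹ * ‖U' q‖ + B * (g₂ q / g₁ q ^ 2) := by
    intro q hq
    have hq' := Ioc_subset_Icc_self hq
    rw [hR, norm_mul, norm_mul, Complex.norm_I, hen, one_mul, mul_one]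
    refine (norm_sub_le _ _).trans (add_le_add ?_ ?_)
    · rw [norm_div, Complex.norm_real, Real.norm_eq_abs, div_eq_inv_mul]
      gcongr
      exact habs q hq'
    · rw [norm_mul, norm_div, norm_pow, Complex.norm_real, Complex.norm_real,
        Real.norm_of_nonneg (hpos q hq'), Real.norm_eq_abs, sq_abs]
      have := hpos q hq'
      gcongr
      exact hB q
  -- The integrand is the derivative of `-1/g₁`. Since `g₁` keeps its sign, the two endpoint values
  -- partly cancel and a single `1/μ` suffices, with no dependence on `g₂` or on the length.
  have hint : ∫ q in c..d, g₂ q / g₁ q ^ 2 ≤ μ⁻¹ := by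
    have hd : ∀ q ∈ uIcc c d, HasDerivAt (fun q => -(g₁ q)⁻¹) (g₂ q / g₁ q ^ 2) q := by
      intro q hq
      rw [uIcc_of_le hcd] at hq
      exact ((d₂ q).inv (hne q hq)).neg.congr_deriv (by ring)
    rw [intervalIntegral.integral_eq_sub_of_hasDerivAt hd hqi]
    have hc' : c ∈ Icc c d := ⟨le_rfl, hcd⟩
    have hd' : d ∈ Icc c d := ⟨hcd, le_rfl⟩
    rcases hlow with h | h
    · have h1 : (g₁ c)⁻¹ ≤ μ⁻¹ := by gcongr; exact h c hc'
      have h2 : 0 ≤ (g₁ d)⁻¹ := inv_nonneg.2 (hμ.le.trans (h d hd'))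
      linarith
    · have h1 : (-g₁ d)⁻¹ ≤ μ⁻¹ := by gcongr; linarith [h d hd']
      have h2 : 0 ≤ (-g₁ c)⁻¹ := inv_nonneg.2 (by linarith [h c hc'])
      rw [inv_neg] at h1 h2
      linarith
  have hcs : ∫ q in c..d, ‖U' q‖ ≤ Real.sqrt (d - c) * Real.sqrt (∫ q, ‖U' q‖ ^ 2) := by
    have hm1 : MemLp (fun q => ‖U' q‖) 2 (volume.restrict (Ioc c d)) :=
      (memLp_two_iff_integrable_sq hU'.norm.aestronglyMeasurable).2 hE.integrableOn
    have key := integral_mul_le_Lp_mul_Lq_of_nonneg (μ := volume.restrict (Ioc c d))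
      Real.HolderConjugate.two_two (f := fun _ => (1 : ℝ)) (g := fun q => ‖U' q‖)
      (.of_forall fun q => zero_le_one) (.of_forall fun q => norm_nonneg _)
      (memLp_const _) (by simpa using hm1)
    rw [← Real.sqrt_eq_rpow, ← Real.sqrt_eq_rpow] at key
    simp only [one_mul, Real.rpow_two, one_pow, integral_const, smul_eq_mul, mul_one] at key
    rw [intervalIntegral.integral_of_le hcd]
    refine key.trans ?_
    apply mul_le_mul
    · apply Real.sqrt_le_sqrt
      simp [measureReal_def, hcd]
    · exact Real.sqrt_le_sqrt (setIntegral_le_integral hE (.of_forall fun q => by positivity))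
    · positivity
    · positivity
  rw [hfin, norm_neg]
  refine (intervalIntegral.norm_integral_le_of_norm_le hcd (.of_forall hle)
    ((hU'i.const_mul _).add (hqi.const_mul _))).trans ?_
  rw [intervalIntegral.integral_add (hU'i.const_mul _) (hqi.const_mul _),
    intervalIntegral.integral_const_mul, intervalIntegral.integral_const_mul, div_eq_inv_mul,
    mul_add, mul_comm μ⁻¹ B]
  gcongr

/-! ### The weight `N` as a function of the origin, and the variance -/

lemma integrable_add_const_mul {g k : ℝ → ℝ} (hg : Integrable g) (hk : Integrable k) (c : ℝ) :
    Integrable (fun x => g x + c * k x) :=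
  hg.add (hk.const_mul c)

lemma integral_add_const_mul {g k : ℝ → ℝ} (hg : Integrable g) (hk : Integrable k) (c : ℝ) :
    ∫ x, (g x + c * k x) = (∫ x, g x) + c * ∫ x, k x := by
  rw [integral_add hg (hk.const_mul c), integral_const_mul]

/-- The Fourier transform of `u_f(t₀, · + x₀)`. -/
def originProfile (f : ℝ → ℝ) (u₀ : ℝ → ℂ) (t₀ x₀ p : ℝ) : ℂ :=
  fourierT u₀ p * Complex.exp (((x₀ * p - t₀ * f p : ℝ) : ℂ) * Complex.I)

/-- The derivative of `originProfile`. -/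
def originProfileDeriv (f : ℝ → ℝ) (u₀ : ℝ → ℂ) (t₀ x₀ p : ℝ) : ℂ :=
  (deriv (fourierT u₀) p + fourierT u₀ p * (((x₀ - t₀ * deriv f p : ℝ) : ℂ) * Complex.I))
    * Complex.exp (((x₀ * p - t₀ * f p : ℝ) : ℂ) * Complex.I)

section

variable {f : ℝ → ℝ} {u₀ : 𝓢(ℝ, ℂ)} {p₁ p₂ : ℝ}

lemma norm_originProfile (f : ℝ → ℝ) (u₀ : ℝ → ℂ) (t₀ x₀ p : ℝ) :
    ‖originProfile f u₀ t₀ x₀ p‖ = ‖fourierT u₀ p‖ := by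
  rw [originProfile, norm_mul, Complex.norm_exp_ofReal_mul_I, mul_one]

lemma fourierT_hasCompactSupport (hsupp : tsupport (fourierT u₀) ⊆ Icc p₁ p₂) :
    HasCompactSupport (fourierT u₀) :=
  isCompact_Icc.of_isClosed_subset (isClosed_tsupport _) hsupp

lemma contDiff_originProfile (hf : ContDiff ℝ (⊤ : ℕ∞) f) (t₀ x₀ : ℝ) :
    ContDiff ℝ (⊤ : ℕ∞) (originProfile f u₀ t₀ x₀) := by
  have h1 : ContDiff ℝ (⊤ : ℕ∞) (fun p : ℝ => ((x₀ * p - t₀ * f p : ℝ) : ℂ)) :=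
    Complex.ofRealCLM.contDiff.comp
      ((contDiff_const.mul contDiff_id).sub (contDiff_const.mul hf))
  exact (fourierT_contDiff u₀).mul (h1.mul contDiff_const).cexp

lemma hasCompactSupport_originProfile (hsupp : tsupport (fourierT u₀) ⊆ Icc p₁ p₂) (t₀ x₀ : ℝ) :
    HasCompactSupport (originProfile f u₀ t₀ x₀) :=
  (fourierT_hasCompactSupport hsupp).mul_right

lemma hasDerivAt_originProfile (hf : ContDiff ℝ (⊤ : ℕ∞) f) (t₀ x₀ p : ℝ) :
    HasDerivAt (originProfile f u₀ t₀ x₀) (originProfileDeriv f u₀ t₀ x₀ p) p := by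
  have h1 : HasDerivAt (fourierT u₀) (deriv (fourierT u₀) p) p :=
    ((fourierT_contDiff u₀).differentiable (by simp) p).hasDerivAt
  have h2 : HasDerivAt f (deriv f p) p := (hf.differentiable (by simp) p).hasDerivAt
  have h3 := (((hasDerivAt_id p).const_mul x₀).sub (h2.const_mul t₀)).ofReal_comp
  have h4 := h1.mul (h3.mul_const Complex.I).cexp
  refine h4.congr_deriv ?_
  simp only [originProfileDeriv, Pi.sub_apply, id, mul_one]
  ring

lemma deriv_originProfile (hf : ContDiff ℝ (⊤ : ℕ∞) f) (t₀ x₀ : ℝ) :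
    deriv (originProfile f u₀ t₀ x₀) = originProfileDeriv f u₀ t₀ x₀ :=
  funext fun p => (hasDerivAt_originProfile hf t₀ x₀ p).deriv

lemma norm_sq_originProfileDeriv (t₀ x₀ p : ℝ) :
    ‖originProfileDeriv f u₀ t₀ x₀ p‖ ^ 2 =
      ‖deriv (fourierT u₀) p‖ ^ 2
        + 2 * (x₀ - t₀ * deriv f p) * ((deriv (fourierT u₀) p).im * (fourierT u₀ p).re
            - (deriv (fourierT u₀) p).re * (fourierT u₀ p).im)
        + (x₀ - t₀ * deriv f p) ^ 2 * ‖fourierT u₀ p‖ ^ 2 := by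
  rw [originProfileDeriv, norm_mul, Complex.norm_exp_ofReal_mul_I, mul_one, ← Complex.normSq_eq_norm_sq,
    ← Complex.normSq_eq_norm_sq, ← Complex.normSq_eq_norm_sq]
  simp only [Complex.normSq_apply, Complex.add_re, Complex.add_im, Complex.mul_re, Complex.mul_im,
    Complex.ofReal_re, Complex.ofReal_im, Complex.I_re, Complex.I_im]
  ring

lemma wave_add_eq_invFourierT (t₀ x₀ x : ℝ) :
    wave f u₀ t₀ (x + x₀) = invFourierT (originProfile f u₀ t₀ x₀) x := by
  rw [wave, invFourierT]
  congr 2 with p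
  rw [originProfile, mul_assoc (fourierT u₀ p), ← Complex.exp_add]
  congr 2
  push_cast
  ring

lemma exists_schwartz_eq_wave (hf : ContDiff ℝ (⊤ : ℕ∞) f)
    (hsupp : tsupport (fourierT u₀) ⊆ Icc p₁ p₂) (t : ℝ) :
    ∃ w : 𝓢(ℝ, ℂ), ⇑w = wave f u₀ t := by
  obtain ⟨w, hw⟩ := exists_schwartz_eq_invFourierT (contDiff_originProfile (u₀ := u₀) hf t 0)
    (hasCompactSupport_originProfile hsupp t 0)
  refine ⟨w, ?_⟩
  ext x
  rw [hw, ← wave_add_eq_invFourierT, add_zero]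

lemma schwartz_integrable_pow_mul_sq (w : 𝓢(ℝ, ℂ)) (k : ℕ) :
    Integrable (fun x : ℝ => x ^ k * ‖w x‖ ^ 2) := by
  obtain ⟨C, hC⟩ := w.decay 0 0
  have hb : ∀ x, ‖w x‖ ≤ C := fun x => by simpa using hC.2 x
  have h := (w.integrable_pow_mul volume k).mul_const C
  refine h.mono' (by have := w.continuous; fun_prop) (.of_forall fun x => ?_)
  rw [norm_mul, norm_pow, norm_pow, norm_norm, sq, ← mul_assoc]
  gcongr
  exact hb x

/-- `N(t₀,x₀)²`, computed in position space. -/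
lemma integral_norm_sq_weighted (hf : ContDiff ℝ (⊤ : ℕ∞) f)
    (hsupp : tsupport (fourierT u₀) ⊆ Icc p₁ p₂) (t₀ x₀ : ℝ) :
    ∫ x : ℝ, ‖weighted f u₀ t₀ x₀ x‖ ^ 2 =
      moment (fun x => x ^ 2) (wave f u₀ t₀) - 2 * x₀ * mean (wave f u₀ t₀)
        + x₀ ^ 2 * ∫ x : ℝ, ‖wave f u₀ t₀ x‖ ^ 2 := by
  obtain ⟨w, hw⟩ := exists_schwartz_eq_wave hf hsupp t₀
  have i0 := schwartz_integrable_pow_mul_sq w 0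
  have i1 := schwartz_integrable_pow_mul_sq w 1
  have i2 := schwartz_integrable_pow_mul_sq w 2
  simp only [weighted, mean, moment, ← hw]
  simp only [pow_zero, one_mul, pow_one] at i0 i1
  rw [sub_eq_add_neg, ← neg_mul, ← integral_add_const_mul i2 i1,
    ← integral_add_const_mul (integrable_add_const_mul i2 i1 _) i0]
  congr 1 with x
  rw [norm_mul, Complex.norm_real, mul_pow, Real.norm_eq_abs, sq_abs]
  ring

lemma memLp_weighted (hf : ContDiff ℝ (⊤ : ℕ∞) f)
    (hsupp : tsupport (fourierT u₀) ⊆ Icc p₁ p₂) (t₀ x₀ : ℝ) :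
    MemLp (weighted f u₀ t₀ x₀) 2 volume := by
  obtain ⟨w, hw⟩ := exists_schwartz_eq_wave hf hsupp t₀
  have i0 := schwartz_integrable_pow_mul_sq w 0
  have i1 := schwartz_integrable_pow_mul_sq w 1
  have i2 := schwartz_integrable_pow_mul_sq w 2
  have hc : Continuous (weighted f u₀ t₀ x₀) := by
    have := w.continuous
    unfold weighted
    rw [← hw]
    fun_prop
  rw [memLp_two_iff_integrable_sq_norm hc.aestronglyMeasurable]
  refine ((i2.sub (i1.const_mul (2 * x₀))).add (i0.const_mul (x₀ ^ 2))).congr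
    (.of_forall fun x => ?_)
  simp only [weighted, ← hw, Pi.add_apply, Pi.sub_apply]
  rw [norm_mul, Complex.norm_real, mul_pow, Real.norm_eq_abs, sq_abs]
  ring

/-- `N(t₀,x₀)²`, computed in frequency space. -/
lemma integral_norm_sq_weighted_eq_originProfileDeriv (hf : ContDiff ℝ (⊤ : ℕ∞) f)
    (hsupp : tsupport (fourierT u₀) ⊆ Icc p₁ p₂) (t₀ x₀ : ℝ) :
    ∫ x : ℝ, ‖weighted f u₀ t₀ x₀ x‖ ^ 2 =
      1 / (2 * Real.pi) * ∫ p : ℝ, ‖originProfileDeriv f u₀ t₀ x₀ p‖ ^ 2 := by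
  rw [← deriv_originProfile hf, ← integral_sq_mul_norm_sq_invFourierT (contDiff_originProfile hf t₀ x₀)
    (hasCompactSupport_originProfile hsupp t₀ x₀),
    ← integral_add_right_eq_self (fun x => ‖weighted f u₀ t₀ x₀ x‖ ^ 2) x₀]
  congr 1 with x
  rw [← wave_add_eq_invFourierT, weighted, norm_mul, Complex.norm_real, mul_pow,
    Real.norm_eq_abs, sq_abs, add_sub_cancel_right]

lemma lpNorm_weighted_sq (hf : ContDiff ℝ (⊤ : ℕ∞) f)
    (hsupp : tsupport (fourierT u₀) ⊆ Icc p₁ p₂) (t₀ x₀ : ℝ) :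
    lpNorm (weighted f u₀ t₀ x₀) 2 volume ^ 2 = ∫ x : ℝ, ‖weighted f u₀ t₀ x₀ x‖ ^ 2 :=
  lpNorm_two_sq_eq_integral (memLp_weighted hf hsupp t₀ x₀).1

lemma integral_norm_sq_wave (hf : ContDiff ℝ (⊤ : ℕ∞) f)
    (hsupp : tsupport (fourierT u₀) ⊆ Icc p₁ p₂) (t : ℝ) :
    ∫ x : ℝ, ‖wave f u₀ t x‖ ^ 2 = ∫ x : ℝ, ‖u₀ x‖ ^ 2 := by
  have h : wave f u₀ t = invFourierT (originProfile f u₀ t 0) := by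
    ext x; rw [← wave_add_eq_invFourierT, add_zero]
  rw [h, integral_norm_sq_invFourierT (contDiff_originProfile hf t 0)
    (hasCompactSupport_originProfile hsupp t 0), ← integral_norm_sq_fourierT]
  simp only [norm_originProfile]

lemma hasVariance_wave (hf : ContDiff ℝ (⊤ : ℕ∞) f)
    (hsupp : tsupport (fourierT u₀) ⊆ Icc p₁ p₂)
    (hnorm : lpNorm (u₀ : ℝ → ℂ) 2 volume = 1) (t : ℝ) : HasVariance (wave f u₀ t) := by
  have hn := lpNorm_two_sq_eq_integral u₀.continuous.aestronglyMeasurable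
  obtain ⟨w, hw⟩ := exists_schwartz_eq_wave hf hsupp t
  have hn2 := lpNorm_two_sq_eq_integral w.continuous.aestronglyMeasurable
  rw [hw, integral_norm_sq_wave hf hsupp, ← hn, hnorm] at hn2
  refine ⟨hw ▸ w.memLp 2 volume, ?_, ?_, ?_⟩
  · exact (sq_eq_sq₀ lpNorm_nonneg zero_le_one).1 hn2
  · simpa [hw] using schwartz_integrable_pow_mul_sq w 1
  · simpa [hw] using schwartz_integrable_pow_mul_sq w 2

/-- The parallel axis theorem: `N(t₀,x₀)² = 𝓥(u_f(t₀)) + (x₀ - 𝓜₁(u_f(t₀)))²`. -/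
lemma lpNorm_weighted_sq_eq_variance (hf : ContDiff ℝ (⊤ : ℕ∞) f)
    (hsupp : tsupport (fourierT u₀) ⊆ Icc p₁ p₂)
    (hnorm : lpNorm (u₀ : ℝ → ℂ) 2 volume = 1) (t₀ x₀ : ℝ) :
    lpNorm (weighted f u₀ t₀ x₀) 2 volume ^ 2 =
      variance (wave f u₀ t₀) + (x₀ - mean (wave f u₀ t₀)) ^ 2 := by
  have hn := lpNorm_two_sq_eq_integral u₀.continuous.aestronglyMeasurable
  rw [lpNorm_weighted_sq hf hsupp, integral_norm_sq_weighted hf hsupp,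
    integral_norm_sq_wave hf hsupp, ← hn, hnorm, variance]
  ring

/-- The mean of `(f')^k` with respect to the momentum density. -/
def velocityMoment (f : ℝ → ℝ) (u₀ : ℝ → ℂ) (k : ℕ) : ℝ :=
  1 / (2 * Real.pi) * ∫ p : ℝ, deriv f p ^ k * ‖fourierT u₀ p‖ ^ 2

lemma integrable_of_continuous_mul_norm_sq (hsupp : tsupport (fourierT u₀) ⊆ Icc p₁ p₂)
    {g : ℝ → ℝ} (hg : Continuous g) : Integrable (fun p => g p * ‖fourierT u₀ p‖ ^ 2) := by
  refine Continuous.integrable_of_hasCompactSupport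
    (by have := (fourierT_contDiff u₀).continuous; fun_prop) ?_
  refine HasCompactSupport.mul_left ?_
  exact (fourierT_hasCompactSupport hsupp).comp_left (g := fun z : ℂ => ‖z‖ ^ 2) (by simp)

lemma integrable_velocity_pow (hf : ContDiff ℝ (⊤ : ℕ∞) f)
    (hsupp : tsupport (fourierT u₀) ⊆ Icc p₁ p₂) (k : ℕ) :
    Integrable (fun p => deriv f p ^ k * ‖fourierT u₀ p‖ ^ 2) :=
  integrable_of_continuous_mul_norm_sq hsupp ((hf.continuous_deriv (by simp)).pow k)

lemma integrable_norm_sq_originProfileDeriv (hf : ContDiff ℝ (⊤ : ℕ∞) f)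
    (hsupp : tsupport (fourierT u₀) ⊆ Icc p₁ p₂) (t₀ x₀ : ℝ) :
    Integrable (fun p => ‖originProfileDeriv f u₀ t₀ x₀ p‖ ^ 2) := by
  have hc := contDiff_originProfile (u₀ := u₀) hf t₀ x₀
  rw [← deriv_originProfile hf]
  refine Continuous.integrable_of_hasCompactSupport
    (by have := hc.continuous_deriv (by simp); fun_prop) ?_
  exact (hasCompactSupport_originProfile hsupp t₀ x₀).deriv.comp_left
    (g := fun z : ℂ => ‖z‖ ^ 2) (by simp)

/-- `N(t₀,x₀)²` is a quadratic polynomial in `(t₀,x₀)`. -/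
lemma exists_quadratic (hf : ContDiff ℝ (⊤ : ℕ∞) f)
    (hsupp : tsupport (fourierT u₀) ⊆ Icc p₁ p₂) :
    ∃ α β γ : ℝ, ∀ t₀ x₀ : ℝ, ∫ x : ℝ, ‖weighted f u₀ t₀ x₀ x‖ ^ 2 =
      α + 2 * t₀ * β + 2 * x₀ * γ + t₀ ^ 2 * velocityMoment f u₀ 2
        - 2 * t₀ * x₀ * velocityMoment f u₀ 1 + x₀ ^ 2 * velocityMoment f u₀ 0 := by
  set A := fourierT u₀ with hA
  have hAc : ContDiff ℝ (⊤ : ℕ∞) A := fourierT_contDiff u₀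
  have hAs : HasCompactSupport A := fourierT_hasCompactSupport hsupp
  set J : ℝ → ℝ := fun p => (deriv A p).im * (A p).re - (deriv A p).re * (A p).im with hJ
  have cA := hAc.continuous
  have cA' := hAc.continuous_deriv (by simp)
  have cf' := hf.continuous_deriv (by simp)
  have iA' : Integrable (fun p => ‖deriv A p‖ ^ 2) :=
    Continuous.integrable_of_hasCompactSupport (by fun_prop)
      (hAs.deriv.comp_left (g := fun z : ℂ => ‖z‖ ^ 2) (by simp))
  have sJ : HasCompactSupport J := by
    refine HasCompactSupport.sub ?_ ?_
    · exact HasCompactSupport.mul_left (hAs.comp_left (g := Complex.re) (by simp))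
    · exact HasCompactSupport.mul_left (hAs.comp_left (g := Complex.im) (by simp))
  have cJ : Continuous J := by fun_prop
  have iJ : Integrable J := cJ.integrable_of_hasCompactSupport sJ
  have iJf : Integrable (fun p => deriv f p * J p) :=
    (cf'.mul cJ).integrable_of_hasCompactSupport sJ.mul_left
  have i0 := integrable_velocity_pow hf hsupp 0
  have i1 := integrable_velocity_pow hf hsupp 1
  have i2 := integrable_velocity_pow hf hsupp 2
  -- The coefficients come from expanding `|A' + i(x₀ - t₀f')A|²`; `J = Im(A' Ā)` is its cross term.
  refine ⟨1 / (2 * Real.pi) * ∫ p, ‖deriv A p‖ ^ 2, -(1 / (2 * Real.pi) * ∫ p, deriv f p * J p),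
    1 / (2 * Real.pi) * ∫ p, J p, fun t₀ x₀ => ?_⟩
  rw [integral_norm_sq_weighted_eq_originProfileDeriv hf hsupp]
  have key : ∫ p : ℝ, ‖originProfileDeriv f u₀ t₀ x₀ p‖ ^ 2 =
      (∫ p, ‖deriv A p‖ ^ 2) + 2 * x₀ * (∫ p, J p) + (-2 * t₀) * (∫ p, deriv f p * J p)
        + t₀ ^ 2 * (∫ p, deriv f p ^ 2 * ‖A p‖ ^ 2)
        + (-2 * t₀ * x₀) * (∫ p, deriv f p ^ 1 * ‖A p‖ ^ 2)
        + x₀ ^ 2 * (∫ p, deriv f p ^ 0 * ‖A p‖ ^ 2) := by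
    have j1 := integrable_add_const_mul iA' iJ (2 * x₀)
    have j2 := integrable_add_const_mul j1 iJf (-2 * t₀)
    have j3 := integrable_add_const_mul j2 i2 (t₀ ^ 2)
    have j4 := integrable_add_const_mul j3 i1 (-2 * t₀ * x₀)
    rw [← integral_add_const_mul iA' iJ, ← integral_add_const_mul j1 iJf,
      ← integral_add_const_mul j2 i2, ← integral_add_const_mul j3 i1,
      ← integral_add_const_mul j4 i0]
    congr 1 with p
    rw [norm_sq_originProfileDeriv]
    simp only [hJ, ← hA]
    ring
  rw [key]
  simp only [velocityMoment]
  ring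

lemma velocityMoment_zero (hnorm : lpNorm (u₀ : ℝ → ℂ) 2 volume = 1) :
    velocityMoment f u₀ 0 = 1 := by
  have hn := lpNorm_two_sq_eq_integral u₀.continuous.aestronglyMeasurable
  simp only [velocityMoment, pow_zero, one_mul]
  rw [integral_norm_sq_fourierT, ← hn, hnorm, one_pow]

/-- The velocity is not deterministic. -/
lemma velocityMoment_one_sq_lt (hf : ContDiff ℝ (⊤ : ℕ∞) f) (hinj : Function.Injective (deriv f))
    (hsupp : tsupport (fourierT u₀) ⊆ Icc p₁ p₂)
    (hnorm : lpNorm (u₀ : ℝ → ℂ) 2 volume = 1) :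
    velocityMoment f u₀ 1 ^ 2 < velocityMoment f u₀ 2 := by
  have cf' := hf.continuous_deriv (by simp)
  set F := velocityMoment f u₀ 1 with hF
  have h0 := velocityMoment_zero (f := f) hnorm
  have i0 := integrable_velocity_pow hf hsupp 0
  have i1 := integrable_velocity_pow hf hsupp 1
  have i2 := integrable_velocity_pow hf hsupp 2
  have cA := (fourierT_contDiff u₀).continuous
  have hid : 1 / (2 * Real.pi) * ∫ p, (deriv f p - F) ^ 2 * ‖fourierT u₀ p‖ ^ 2
      = velocityMoment f u₀ 2 - F ^ 2 := by
    have e : ∫ p, (deriv f p - F) ^ 2 * ‖fourierT u₀ p‖ ^ 2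
        = (∫ p, deriv f p ^ 2 * ‖fourierT u₀ p‖ ^ 2)
          + (-2 * F) * (∫ p, deriv f p ^ 1 * ‖fourierT u₀ p‖ ^ 2)
          + F ^ 2 * (∫ p, deriv f p ^ 0 * ‖fourierT u₀ p‖ ^ 2) := by
      rw [← integral_add_const_mul i2 i1,
        ← integral_add_const_mul (integrable_add_const_mul i2 i1 _) i0]
      congr 1 with p
      ring
    have e2 : 1 / (2 * Real.pi) * ∫ p, (deriv f p - F) ^ 2 * ‖fourierT u₀ p‖ ^ 2
        = velocityMoment f u₀ 2 + (-2 * F) * velocityMoment f u₀ 1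
          + F ^ 2 * velocityMoment f u₀ 0 := by
      rw [e]; simp only [velocityMoment]; ring
    rw [e2, h0, ← hF]
    ring
  obtain ⟨p, hp, hpF⟩ : ∃ p, fourierT u₀ p ≠ 0 ∧ deriv f p ≠ F := by
    -- If `f'` were constant where `ℱu₀ ≠ 0`, injectivity would leave at most one point there. That
    -- set is open, hence empty, contradicting normalisation.
    by_contra! hcon
    have hsub : (Function.support (fourierT u₀)).Subsingleton := fun p hp q hq =>
      hinj ((hcon p hp).trans (hcon q hq).symm)
    have hz : fourierT u₀ = 0 := by
      by_contra hne
      have hopen : IsOpen (Function.support (fourierT u₀)) := cA.isOpen_support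
      obtain ⟨p, hp⟩ := Function.support_nonempty_iff.2 hne
      have hs : Function.support (fourierT u₀) = {p} :=
        hsub.eq_singleton_of_mem hp
      rw [hs] at hopen
      exact not_isOpen_singleton p hopen
    simp [velocityMoment, hz] at h0
  have hpos : 0 < ∫ p, (deriv f p - F) ^ 2 * ‖fourierT u₀ p‖ ^ 2 := by
    refine integral_pos_of_integrable_nonneg_nonzero (x := p) (by fun_prop)
      (integrable_of_continuous_mul_norm_sq hsupp (by fun_prop)) (fun q => by positivity) ?_
    have := sub_ne_zero.2 hpF
    have := norm_ne_zero_iff.2 hp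
    positivity
  have : 0 < velocityMoment f u₀ 2 - F ^ 2 := by rw [← hid]; positivity
  linarith

/-- The variance is a strictly convex quadratic polynomial in time. -/
lemma exists_variance_eq (hf : ContDiff ℝ (⊤ : ℕ∞) f) (hinj : Function.Injective (deriv f))
    (hsupp : tsupport (fourierT u₀) ⊆ Icc p₁ p₂)
    (hnorm : lpNorm (u₀ : ℝ → ℂ) 2 volume = 1) :
    ∃ κ tstar v : ℝ, 0 < κ ∧ ∀ τ, variance (wave f u₀ τ) = κ * (τ - tstar) ^ 2 + v := by
  obtain ⟨α, β, γ, hQ⟩ := exists_quadratic (f := f) hf hsupp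
  have hlt := velocityMoment_one_sq_lt hf hinj hsupp hnorm
  have hP := fun t₀ x₀ => lpNorm_weighted_sq_eq_variance hf hsupp hnorm t₀ x₀
  simp only [lpNorm_weighted_sq hf hsupp, hQ, velocityMoment_zero hnorm] at hP
  set F := velocityMoment f u₀ 1
  set κ := velocityMoment f u₀ 2 - F ^ 2 with hκ
  have hκ0 : 0 < κ := by linarith
  -- Vertex form of the parabola computed in `hv`. The mean, affine in time, is read off by
  -- comparing the parallel axis identity at `x₀ = 0` and `x₀ = 1`.
  refine ⟨κ, -(β + γ * F) / κ, α - γ ^ 2 - (β + γ * F) ^ 2 / κ, hκ0, fun τ => ?_⟩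
  have e0 := hP τ 0
  have e1 := hP τ 1
  have hm : mean (wave f u₀ τ) = τ * F - γ := by linarith
  rw [hm] at e0
  have hv : variance (wave f u₀ τ) = α - γ ^ 2 + 2 * τ * (β + γ * F) + κ * τ ^ 2 := by
    rw [hκ]; linarith
  rw [hv]
  field_simp
  ring

end

/-! ### Pointwise bounds and the comparison of constants -/

/-- By continuity, exceeding the essential supremum at one point of the closed interval would mean
exceeding it on a nonempty open subset of the open interval, which is not null. -/
lemma norm_le_supNorm {g : ℝ → ℝ} (hg : Continuous g) {a b q : ℝ} (hab : a < b)
    (hq : q ∈ Icc a b) : |g q| ≤ supNorm g a b := by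
  obtain ⟨C, hC⟩ := isCompact_Icc.exists_bound_of_continuousOn (hg.continuousOn (s := Icc a b))
  have hmem : MemLp g ∞ (volume.restrict (Ioo a b)) := by
    refine memLp_top_of_bound hg.aestronglyMeasurable C ?_
    filter_upwards [ae_restrict_mem measurableSet_Ioo] with x hx using hC x (Ioo_subset_Icc_self hx)
  have hae := (ae_restrict_iff' measurableSet_Ioo).1 (ae_le_lpNorm_exponent_top hmem)
  have hdense := Measure.dense_of_ae hae
  by_contra! hcon
  have hopen : IsOpen {x | supNorm g a b < |g x|} := isOpen_lt continuous_const hg.abs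
  have hne : ({x | supNorm g a b < |g x|} ∩ Ioo a b).Nonempty :=
    mem_closure_iff.1 (by rwa [closure_Ioo hab.ne]) _ hopen hcon
  obtain ⟨x, ⟨hx1, hx2⟩, hx3⟩ := hdense.inter_open_nonempty _ (hopen.inter isOpen_Ioo) hne
  exact absurd (hx3 hx2) (not_le.2 hx1)

lemma minOn_le {g : ℝ → ℝ} (hg : Continuous g) {a b q : ℝ} (hq : q ∈ Icc a b) :
    minOn g a b ≤ g q :=
  csInf_le (isCompact_Icc.image hg).bddBelow (mem_image_of_mem g hq)

lemma minOn_pos {g : ℝ → ℝ} (hg : Continuous g) {a b : ℝ} (hab : a ≤ b) (hpos : ∀ q, 0 < g q) :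
    0 < minOn g a b := by
  obtain ⟨q, -, hq⟩ := (isCompact_Icc.image hg).sInf_mem ((nonempty_Icc.2 hab).image g)
  rw [minOn, ← hq]
  exact hpos q

/-- The phase scales linearly in the elapsed time `T`, and the powers of `T` collect to `T^{-δ}`.
Writing every positive base as an exponential turns the identity into a linear one between
exponents. -/
lemma phase_exponent_first {T m M δ : ℝ} (hT : 0 < T) (hm : 0 < m) (hM : 0 < M) :
    Real.sqrt (T * m / 2) ^ (1 - 2 * δ) * (2 * Real.sqrt (T * M / 2) / (T * m)) =
      T ^ (-δ) * (2 : ℝ) ^ δ * (M ^ (1 / 2 : ℝ) * m ^ (-(1 / 2) - δ)) := by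
  obtain ⟨τ, rfl⟩ : ∃ τ, T = Real.exp τ := ⟨_, (Real.exp_log hT).symm⟩
  obtain ⟨n, rfl⟩ : ∃ n, m = Real.exp n := ⟨_, (Real.exp_log hm).symm⟩
  obtain ⟨N, rfl⟩ : ∃ N, M = Real.exp N := ⟨_, (Real.exp_log hM).symm⟩
  obtain ⟨l, hl⟩ : ∃ l, (2 : ℝ) = Real.exp l := ⟨_, (Real.exp_log two_pos).symm⟩
  have e1 : ∀ x y : ℝ, Real.sqrt (Real.exp x * Real.exp y / 2) = Real.exp ((x + y - l) * (1 / 2)) := by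
    intro x y
    rw [Real.exp_mul, ← Real.sqrt_eq_rpow, Real.exp_sub, Real.exp_add, hl]
  have e2 : (2 : ℝ) ^ δ = Real.exp (l * δ) := by rw [hl, ← Real.exp_mul]
  have e3 : ∀ y : ℝ, 2 * Real.exp y = Real.exp (l + y) := fun y => by rw [Real.exp_add, ← hl]
  rw [e1, e1, e2, e3]
  simp only [← Real.exp_mul, ← Real.exp_add, ← Real.exp_sub]
  congr 1
  ring

lemma phase_exponent_second {T m M M₃ δ : ℝ} (hT : 0 < T) (hm : 0 < m) (hM : 0 < M) :
    Real.sqrt (T * m / 2) ^ (1 - 2 * δ) *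
        ((T * M) * (T * M₃) / 3 / (Real.sqrt (T * m / 2) * (T * m) ^ 2)) =
      T ^ (-δ) * (2 : ℝ) ^ δ * (M₃ / 3) * (M * m ^ (-2 - δ)) := by
  obtain ⟨τ, rfl⟩ : ∃ τ, T = Real.exp τ := ⟨_, (Real.exp_log hT).symm⟩
  obtain ⟨n, rfl⟩ : ∃ n, m = Real.exp n := ⟨_, (Real.exp_log hm).symm⟩
  obtain ⟨N, rfl⟩ : ∃ N, M = Real.exp N := ⟨_, (Real.exp_log hM).symm⟩
  obtain ⟨l, hl⟩ : ∃ l, (2 : ℝ) = Real.exp l := ⟨_, (Real.exp_log two_pos).symm⟩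
  have e1 : ∀ x y : ℝ, Real.sqrt (Real.exp x * Real.exp y / 2) = Real.exp ((x + y - l) * (1 / 2)) := by
    intro x y
    rw [Real.exp_mul, ← Real.sqrt_eq_rpow, Real.exp_sub, Real.exp_add, hl]
  have e2 : (2 : ℝ) ^ δ = Real.exp (l * δ) := by rw [hl, ← Real.exp_mul]
  have e3 : (Real.exp τ * Real.exp n) ^ 2 = Real.exp (2 * (τ + n)) := by
    rw [← Real.exp_add, ← Real.exp_nat_mul]; norm_num
  rw [e1, e2, e3]
  have h : ∀ A X Y Z : ℝ, A * (X * (Y * M₃) / 3 / Z) = (M₃ / 3) * (A * (X * Y / Z)) := by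
    intros; ring
  have h' : ∀ A X Z : ℝ, A * X * (M₃ / 3) * Z = (M₃ / 3) * (A * X * Z) := by
    intros; ring
  rw [h, h']
  simp only [← Real.exp_mul, ← Real.exp_add, ← Real.exp_sub]
  congr 2
  ring

/-- At fixed total degree, shifting exponent from `m` to `M` multiplies by a power of `M/m ≥ 1`. It
relaxes the constants of the stationary phase estimate to the stated ones. -/
lemma rpow_mul_rpow_le {m M x y z w : ℝ} (hm : 0 < m) (hmM : m ≤ M) (hxz : x ≤ z)
    (h : x + y = z + w) : M ^ x * m ^ y ≤ M ^ z * m ^ w := by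
  have hM : 0 < M := hm.trans_le hmM
  have e1 : M ^ z = M ^ x * M ^ (z - x) := by rw [← Real.rpow_add hM]; congr 1; ring
  have e2 : m ^ y = m ^ w * m ^ (z - x) := by rw [← Real.rpow_add hm]; congr 1; linarith
  rw [e1, e2]
  have : m ^ (z - x) ≤ M ^ (z - x) := Real.rpow_le_rpow hm.le hmM (by linarith)
  calc _ = M ^ x * m ^ w * m ^ (z - x) := by ring
    _ ≤ M ^ x * m ^ w * M ^ (z - x) := by gcongr
    _ = _ := by ring

lemma two_mul_phaseBound_le {δ T m M₂ M₃ ℓ N B : ℝ} (hδ : δ ∈ Ioo (1 / 2 : ℝ) (3 / 4))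
    (hT : 0 < T) (hm : 0 < m) (hmM : m ≤ M₂) (hM₃ : 0 ≤ M₃) (hℓ : 0 < ℓ) (hN : 0 ≤ N) (hB : 0 ≤ B) :
    1 / (2 * Real.pi) *
        (2 * phaseBound δ (T * m) (T * M₂) (T * M₃) ℓ (2 * Real.pi * N ^ 2) B) ≤
      ((2 : ℝ) ^ (δ + 1 / 2) * constL δ / (Real.sqrt Real.pi * Real.sqrt (3 - 4 * δ))
          * ℓ ^ ((3 - 4 * δ) / 2) * (M₂ ^ (3 / 2 - δ) * m ^ (-(3 / 2) : ℝ)) * N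
        + (2 : ℝ) ^ (δ - 2) * constL δ / (Real.pi * (1 - δ)) * ℓ ^ (2 - 2 * δ)
          * (M₂ ^ (5 / 2 - δ) * M₃ * m ^ (-(7 / 2) : ℝ)
            + 1 / 3 * (M₂ ^ (7 / 2 - δ) * M₃ * m ^ (-(9 / 2) : ℝ))) * B) * T ^ (-δ) := by
  obtain ⟨hδ1, hδ2⟩ := hδ
  have hM : 0 < M₂ := hm.trans_le hmM
  have h3 : 0 < 3 - 4 * δ := by linarith
  have h1 : 0 < 1 - δ := by linarith
  have hpi := Real.pi_pos
  have hL := constL_pos δ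
  set Y₁ := M₂ ^ (1 / 2 : ℝ) * m ^ (-(1 / 2) - δ) with hY₁
  set Y₂ := M₂ * m ^ (-2 - δ) with hY₂
  have hE : Real.sqrt (2 * Real.pi * N ^ 2) = Real.sqrt 2 * Real.sqrt Real.pi * N := by
    rw [Real.sqrt_mul (by positivity), Real.sqrt_sq hN, Real.sqrt_mul (by norm_num)]
  have hS : Real.sqrt (ℓ ^ (3 - 4 * δ) / (3 - 4 * δ))
      = ℓ ^ ((3 - 4 * δ) / 2) / Real.sqrt (3 - 4 * δ) := by
    rw [Real.sqrt_div (by positivity), Real.sqrt_eq_rpow (ℓ ^ (3 - 4 * δ)), ← Real.rpow_mul hℓ.le]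
    congr 2
    ring
  have hsplit : 1 / (2 * Real.pi) *
        (2 * phaseBound δ (T * m) (T * M₂) (T * M₃) ℓ (2 * Real.pi * N ^ 2) B)
      = 1 / Real.pi * constL δ *
        (Real.sqrt (T * m / 2) ^ (1 - 2 * δ) * (2 * Real.sqrt (T * M₂ / 2) / (T * m))
            * (Real.sqrt 2 * Real.sqrt Real.pi * N * (ℓ ^ ((3 - 4 * δ) / 2) / Real.sqrt (3 - 4 * δ)))
          + B * (Real.sqrt (T * m / 2) ^ (1 - 2 * δ) *
              ((T * M₂) * (T * M₃) / 3 / (Real.sqrt (T * m / 2) * (T * m) ^ 2)))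
            * (ℓ ^ (2 - 2 * δ) / (2 - 2 * δ))) := by
    rw [phaseBound, hE, hS]
    field_simp
  rw [hsplit, phase_exponent_first hT hm hM, phase_exponent_second hT hm hM, ← hY₁, ← hY₂]
  have g1 : Y₁ ≤ M₂ ^ (3 / 2 - δ) * m ^ (-(3 / 2) : ℝ) :=
    rpow_mul_rpow_le hm hmM (by linarith) (by ring)
  have hY₂' : Y₂ = M₂ ^ (1 : ℝ) * m ^ (-2 - δ) := by rw [hY₂, Real.rpow_one]
  have g2 : Y₂ ≤ M₂ ^ (5 / 2 - δ) * m ^ (-(7 / 2) : ℝ) :=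
    hY₂' ▸ rpow_mul_rpow_le hm hmM (by linarith) (by ring)
  have g3 : Y₂ ≤ M₂ ^ (7 / 2 - δ) * m ^ (-(9 / 2) : ℝ) :=
    hY₂' ▸ rpow_mul_rpow_le hm hmM (by linarith) (by ring)
  have hY₂0 : 0 < Y₂ := by positivity
  have e2 : (2 : ℝ) ^ (δ + 1 / 2) = 2 ^ δ * Real.sqrt 2 := by
    rw [Real.rpow_add two_pos, Real.sqrt_eq_rpow]
  have e3 : (2 : ℝ) ^ (δ - 2) = 2 ^ δ / 4 := by
    rw [Real.rpow_sub two_pos]; norm_num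
  have hsp : Real.sqrt Real.pi * Real.sqrt Real.pi = Real.pi := Real.mul_self_sqrt hpi.le
  calc _ = ((2 : ℝ) ^ (δ + 1 / 2) * constL δ / (Real.sqrt Real.pi * Real.sqrt (3 - 4 * δ))
          * ℓ ^ ((3 - 4 * δ) / 2) * Y₁ * N
        + (2 : ℝ) ^ (δ - 2) * constL δ / (Real.pi * (1 - δ)) * ℓ ^ (2 - 2 * δ)
          * (2 / 3 * (M₃ * Y₂)) * B) * T ^ (-δ) := by
        rw [e2, e3, show 2 - 2 * δ = 2 * (1 - δ) by ring]
        have hs3 : Real.sqrt (3 - 4 * δ) ≠ 0 := (Real.sqrt_pos.2 h3).ne'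
        have hsp0 : Real.sqrt Real.pi ≠ 0 := (Real.sqrt_pos.2 hpi).ne'
        generalize Real.sqrt Real.pi = P at hsp hsp0 ⊢
        rw [← hsp]
        field_simp
        ring
    _ ≤ _ := by
        -- The integration by parts gives the coefficient `2/3`, while the stated constant allows `1
        -- + 1/3`.
        have hlast : 2 / 3 * (M₃ * Y₂) ≤ M₂ ^ (5 / 2 - δ) * M₃ * m ^ (-(7 / 2) : ℝ)
            + 1 / 3 * (M₂ ^ (7 / 2 - δ) * M₃ * m ^ (-(9 / 2) : ℝ)) := by
          have i2 := mul_le_mul_of_nonneg_left g2 hM₃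
          have i3 := mul_le_mul_of_nonneg_left g3 hM₃
          have i0 : 0 ≤ M₃ * Y₂ := by positivity
          nlinarith
        gcongr

/-! ### Stationary phase for both directions of time -/

lemma conj_intervalIntegral (F : ℝ → ℂ) (c d : ℝ) :
    (starRingEnd ℂ) (∫ q in c..d, F q) = ∫ q in c..d, (starRingEnd ℂ) (F q) := by
  simp [intervalIntegral, integral_conj]

lemma conj_integrand (z : ℂ) (r : ℝ) :
    (starRingEnd ℂ) (z * Complex.exp (-(Complex.I * r)))
      = (starRingEnd ℂ) z * Complex.exp (-(Complex.I * ((-r : ℝ) : ℂ))) := by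
  rw [map_mul, ← Complex.exp_conj]
  simp

lemma exp_neg_sign_mul_I {T : ℝ} (hT : T ≠ 0) :
    Complex.exp (-(Real.sign T * Complex.I * (Real.pi / 4)))
      = (Real.sqrt 2 : ℂ) / 2 * (1 - (Real.sign T : ℂ) * Complex.I) := by
  have h : -((Real.sign T : ℂ) * Complex.I * (Real.pi / 4))
      = ((-(Real.sign T * (Real.pi / 4)) : ℝ) : ℂ) * Complex.I := by push_cast; ring
  rw [h, Complex.exp_mul_I, ← Complex.ofReal_cos, ← Complex.ofReal_sin, Real.cos_neg, Real.sin_neg]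
  rcases lt_or_gt_of_ne hT with h | h
  · rw [Real.sign_of_neg h, neg_one_mul, Real.cos_neg, Real.sin_neg, Real.cos_pi_div_four,
      Real.sin_pi_div_four]
    push_cast; ring
  · rw [Real.sign_of_pos h, one_mul, Real.cos_pi_div_four, Real.sin_pi_div_four]
    push_cast; ring

section

variable {f : ℝ → ℝ}

lemma hasDerivAt_iteratedDeriv (hf : ContDiff ℝ (⊤ : ℕ∞) f) (n : ℕ) (q : ℝ) :
    HasDerivAt (iteratedDeriv n f) (iteratedDeriv (n + 1) f q) q := by
  rw [iteratedDeriv_succ]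
  exact (hf.differentiable_iteratedDeriv n (by exact_mod_cast WithTop.coe_lt_top _) q).hasDerivAt

lemma hasDerivAt_deriv (hf : ContDiff ℝ (⊤ : ℕ∞) f) (q : ℝ) :
    HasDerivAt (deriv f) (iteratedDeriv 2 f q) q := by
  have := hasDerivAt_iteratedDeriv hf 1 q
  rwa [iteratedDeriv_one] at this

lemma continuous_iteratedDeriv_of_smooth (hf : ContDiff ℝ (⊤ : ℕ∞) f) (n : ℕ) :
    Continuous (iteratedDeriv n f) :=
  continuous_iff_continuousAt.2 fun q => (hasDerivAt_iteratedDeriv hf n q).continuousAt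

lemma strictMono_deriv (hf : ContDiff ℝ (⊤ : ℕ∞) f) (hconv : ∀ p : ℝ, 0 < iteratedDeriv 2 f p) :
    StrictMono (deriv f) :=
  strictMono_of_hasDerivAt_pos (hasDerivAt_deriv hf) hconv

/-- The stationary phase estimate for the phase `T f(q) - X q`, of either sign of `T`. -/
theorem norm_integral_sub_le_of_ne_zero (hf : ContDiff ℝ (⊤ : ℕ∞) f)
    (hconv : ∀ p : ℝ, 0 < iteratedDeriv 2 f p) {a b p₀ T X : ℝ} (hab : a < b) (hT : T ≠ 0)
    (hp₀ : p₀ ∈ Icc a b) (hcrit : T * deriv f p₀ = X) {U U' : ℝ → ℂ}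
    (hU : ∀ q, HasDerivAt U (U' q) q) (hU' : Continuous U')
    (hE : Integrable (fun q => ‖U' q‖ ^ 2)) (hUa : U a = 0) (hUb : U b = 0) {B : ℝ}
    (hB : ∀ q, ‖U q‖ ≤ B) {δ : ℝ} (hδ : δ ∈ Ioo (1 / 2 : ℝ) (3 / 4)) :
    ‖(∫ q in a..b, U q * Complex.exp (-(Complex.I * ((T * f q - X * q : ℝ) : ℂ))))
        - Complex.exp (-(Complex.I * ((T * f p₀ - X * p₀ : ℝ) : ℂ)))
          * (U p₀ * (Real.sqrt (2 / (|T| * iteratedDeriv 2 f p₀)) : ℂ)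
          * ((Real.sqrt 2 : ℂ) / 2 * (1 - (Real.sign T : ℂ) * Complex.I))
          * ((Real.sqrt Real.pi : ℝ) : ℂ))‖ ≤
      2 * phaseBound δ (|T| * minOn (iteratedDeriv 2 f) a b)
        (|T| * supNorm (iteratedDeriv 2 f) a b) (|T| * supNorm (iteratedDeriv 3 f) a b)
        (b - a) (∫ q, ‖U' q‖ ^ 2) B := by
  have c2 := continuous_iteratedDeriv_of_smooth hf 2
  have c3 := continuous_iteratedDeriv_of_smooth hf 3
  have hm := minOn_pos c2 hab.le hconv
  have hlow : ∀ q ∈ Icc a b, |T| * minOn (iteratedDeriv 2 f) a b ≤ |T| * iteratedDeriv 2 f q :=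
    fun q hq => mul_le_mul_of_nonneg_left (minOn_le c2 hq) (abs_nonneg T)
  have hupp : ∀ q ∈ Icc a b, |T| * iteratedDeriv 2 f q ≤ |T| * supNorm (iteratedDeriv 2 f) a b :=
    fun q hq => mul_le_mul_of_nonneg_left
      ((le_abs_self _).trans (norm_le_supNorm c2 hab hq)) (abs_nonneg T)
  have hupp₃ : ∀ q ∈ Icc a b, |(|T| * iteratedDeriv 3 f q)| ≤
      |T| * supNorm (iteratedDeriv 3 f) a b := fun q hq => by
    rw [abs_mul, abs_abs]
    exact mul_le_mul_of_nonneg_left (norm_le_supNorm c3 hab hq) (abs_nonneg T)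
  have hm' : 0 < |T| * minOn (iteratedDeriv 2 f) a b := mul_pos (abs_pos.2 hT) hm
  have df : ∀ q, HasDerivAt f (deriv f q) q := fun q => (hf.differentiable (by simp) q).hasDerivAt
  -- Here `s` is the sign of `T`, so the phase `s(Tf - Xq)` is always convex. For `T < 0` the
  -- integral is conjugated, which flips the phase and preserves the norms of the amplitude and its
  -- derivative.
  have key : ∀ (s : ℝ) (V V' : ℝ → ℂ), s * T = |T| → (∀ q, HasDerivAt V (V' q) q) → Continuous V' →
      (∀ q, ‖V' q‖ = ‖U' q‖) → (∀ q, ‖V q‖ = ‖U q‖) →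
      ‖(∫ q in a..b, V q * Complex.exp (-(Complex.I * ((s * (T * f q - X * q) : ℝ) : ℂ))))
        - Complex.exp (-(Complex.I * ((s * (T * f p₀ - X * p₀) : ℝ) : ℂ)))
          * (V p₀ * (Real.sqrt (2 / (|T| * iteratedDeriv 2 f p₀)) : ℂ)
          * ((Real.sqrt 2 : ℂ) / 2 * (1 - Complex.I)) * ((Real.sqrt Real.pi : ℝ) : ℂ))‖ ≤
      2 * phaseBound δ (|T| * minOn (iteratedDeriv 2 f) a b)
        (|T| * supNorm (iteratedDeriv 2 f) a b) (|T| * supNorm (iteratedDeriv 3 f) a b)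
        (b - a) (∫ q, ‖U' q‖ ^ 2) B := by
    intro s V V' hs hV hV' hn' hn
    have := norm_integral_sub_le_two_mul_phaseBound (g := fun q => s * (T * f q - X * q))
      (g₁ := fun q => s * (T * deriv f q - X)) (g₂ := fun q => |T| * iteratedDeriv 2 f q)
      (g₃ := fun q => |T| * iteratedDeriv 3 f q) (p₀ := p₀)
      (fun q => ((((df q).const_mul T).sub ((hasDerivAt_id q).const_mul X)).const_mul s).congr_deriv
        (by simp))
      (fun q => ((((hasDerivAt_deriv hf q).const_mul T).sub_const X).const_mul s).congr_deriv
        (by rw [← mul_assoc, hs]))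
      (fun q => (hasDerivAt_iteratedDeriv hf 2 q).const_mul _) hp₀ (by simp [hcrit]) hm' hlow hupp
      hupp₃ hV hV' (by simpa only [hn'] using hE)
      (norm_eq_zero.1 (by rw [hn, hUa, norm_zero])) (norm_eq_zero.1 (by rw [hn, hUb, norm_zero]))
      (fun q => (hn q).trans_le (hB q)) hδ
    simpa only [hn'] using this
  rcases lt_or_gt_of_ne hT with h | h
  · have := key (-1) (fun q => (starRingEnd ℂ) (U q)) (fun q => (starRingEnd ℂ) (U' q))
      (by rw [abs_of_neg h]; ring)
      (fun q => (hU q).star)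
      (Complex.continuous_conj.comp hU') (fun q => by simp) (fun q => by simp)
    rw [← Complex.norm_conj, map_sub, conj_intervalIntegral]
    simp only [conj_integrand]
    simp only [neg_one_mul] at this
    convert this using 3
    rw [map_mul, ← Complex.exp_conj, Real.sign_of_neg h]
    simp only [map_mul, map_neg, map_sub, map_one, Complex.conj_I, Complex.conj_ofReal, map_div₀,
      map_ofNat]
    push_cast
    ring_nf
  · have := key 1 U U' (by rw [abs_of_pos h, one_mul]) hU hU' (fun q => rfl) (fun q => rfl)
    simpa only [one_mul, Real.sign_of_pos h, Complex.ofReal_one] using this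

end

/-! ### Estimates for the wave packet inside and outside a cone -/

section

variable {f : ℝ → ℝ} {u₀ : 𝓢(ℝ, ℂ)} {p₁ p₂ : ℝ}

/-- An open set inside a closed interval lies in its interior. So the amplitude vanishes at `p₁` and
`p₂` themselves, which removes the boundary terms when integrating over exactly `[p₁,p₂]`. -/
lemma support_fourierT_subset (hsupp : tsupport (fourierT u₀) ⊆ Icc p₁ p₂) :
    Function.support (fourierT u₀) ⊆ Ioo p₁ p₂ := by
  rw [← interior_Icc]
  exact interior_maximal ((subset_tsupport _).trans hsupp)
    (fourierT_contDiff u₀).continuous.isOpen_support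

lemma originProfile_eq_zero (hsupp : tsupport (fourierT u₀) ⊆ Icc p₁ p₂) {p : ℝ}
    (hp : p ∉ Ioo p₁ p₂) (t₀ x₀ : ℝ) : originProfile f u₀ t₀ x₀ p = 0 := by
  have : fourierT u₀ p = 0 := by
    by_contra h
    exact hp (support_fourierT_subset hsupp h)
  rw [originProfile, this, zero_mul]

/-- The wave packet as an oscillatory integral with phase relative to the origin `(t₀,x₀)`. -/
lemma wave_eq_intervalIntegral (hsupp : tsupport (fourierT u₀) ⊆ Icc p₁ p₂) {c d : ℝ}
    (hc : c ≤ p₁) (hd : p₂ ≤ d) (t₀ x₀ t x : ℝ) :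
    wave f u₀ t x = 1 / (2 * Real.pi) * ∫ p in c..d, originProfile f u₀ t₀ x₀ p *
      Complex.exp (-(Complex.I * (((t - t₀) * f p - (x - x₀) * p : ℝ) : ℂ))) := by
  rw [intervalIntegral.integral_eq_integral_of_support_subset, wave]
  · congr 2 with p
    rw [originProfile, mul_assoc (fourierT u₀ p), ← Complex.exp_add]
    congr 2
    push_cast
    ring
  · intro p hp
    by_contra hcon
    apply hp
    simp only
    rw [originProfile_eq_zero hsupp _ t₀ x₀, zero_mul]
    exact fun h => hcon ⟨hc.trans_lt h.1, h.2.le.trans hd⟩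

lemma norm_originProfile_le_lpNorm (t₀ x₀ p : ℝ) :
    ‖originProfile f u₀ t₀ x₀ p‖ ≤ lpNorm u₀ 1 volume := by
  rw [norm_originProfile, lpNorm_one_eq_integral_norm u₀.continuous.aestronglyMeasurable]
  exact norm_fourierT_le u₀ p

lemma continuous_originProfileDeriv (hf : ContDiff ℝ (⊤ : ℕ∞) f) (t₀ x₀ : ℝ) :
    Continuous (originProfileDeriv f u₀ t₀ x₀) := by
  rw [← deriv_originProfile hf]
  exact (contDiff_originProfile hf t₀ x₀).continuous_deriv (by simp)

lemma integral_norm_sq_originProfileDeriv (hf : ContDiff ℝ (⊤ : ℕ∞) f)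
    (hsupp : tsupport (fourierT u₀) ⊆ Icc p₁ p₂) (t₀ x₀ : ℝ) :
    ∫ p : ℝ, ‖originProfileDeriv f u₀ t₀ x₀ p‖ ^ 2 =
      2 * Real.pi * lpNorm (weighted f u₀ t₀ x₀) 2 volume ^ 2 := by
  rw [lpNorm_weighted_sq hf hsupp, integral_norm_sq_weighted_eq_originProfileDeriv hf hsupp,
    ← mul_assoc, mul_one_div_cancel (by positivity), one_mul]

/-- The cone condition is what the intermediate value theorem needs for `f'` on `[a,b]`; injectivity
of `f'` then identifies the point found with the value of `Function.invFun`. -/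
lemma exists_statPoint (hf : ContDiff ℝ (⊤ : ℕ∞) f) (hconv : ∀ p : ℝ, 0 < iteratedDeriv 2 f p)
    {a b t₀ x₀ t x : ℝ} (hab : a ≤ b) (hz : (t, x) ∈ cone f a b t₀ x₀) :
    statPoint f t₀ x₀ t x ∈ Icc a b ∧
      (t - t₀) * deriv f (statPoint f t₀ x₀ t x) = x - x₀ := by
  obtain ⟨ht, h1, h2⟩ := hz
  simp only at ht h1 h2
  obtain ⟨p, hp, hpv⟩ := intermediate_value_Icc hab
    (hf.continuous_deriv (by simp)).continuousOn ⟨h1, h2⟩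
  have hs : statPoint f t₀ x₀ t x = p := by
    rw [statPoint, ← hpv]
    exact Function.leftInverse_invFun (strictMono_deriv hf hconv).injective p
  rw [hs, hpv]
  exact ⟨hp, mul_div_cancel₀ _ (sub_ne_zero.2 ht)⟩

lemma firstTerm_eq (hconv : ∀ p : ℝ, 0 < iteratedDeriv 2 f p) {t₀ t : ℝ} (ht : t - t₀ ≠ 0)
    (x₀ x : ℝ) :
    firstTerm f u₀ t₀ x₀ t x = 1 / (2 * Real.pi) *
      (Complex.exp (-(Complex.I * (((t - t₀) * f (statPoint f t₀ x₀ t x)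
          - (x - x₀) * statPoint f t₀ x₀ t x : ℝ) : ℂ)))
        * (originProfile f u₀ t₀ x₀ (statPoint f t₀ x₀ t x)
          * (Real.sqrt (2 / (|t - t₀| * iteratedDeriv 2 f (statPoint f t₀ x₀ t x))) : ℂ)
          * ((Real.sqrt 2 : ℂ) / 2 * (1 - (Real.sign (t - t₀) : ℂ) * Complex.I))
          * ((Real.sqrt Real.pi : ℝ) : ℂ))) := by
  rw [firstTerm, ← exp_neg_sign_mul_I ht]
  set p := statPoint f t₀ x₀ t x
  have hT : 0 < |t - t₀| := abs_pos.2 ht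
  have hp := hconv p
  have hpi := Real.pi_pos
  have e1 : Complex.exp (-(Complex.I * t * f p) + Complex.I * x * p)
      = Complex.exp (-(Complex.I * (((t - t₀) * f p - (x - x₀) * p : ℝ) : ℂ)))
        * Complex.exp (((x₀ * p - t₀ * f p : ℝ) : ℂ) * Complex.I) := by
    rw [← Complex.exp_add]
    congr 1
    push_cast
    ring
  have e2 : 1 / Real.sqrt (2 * Real.pi) * (1 / Real.sqrt (iteratedDeriv 2 f p))
        * |t - t₀| ^ (-(1 / 2) : ℝ)
      = 1 / (2 * Real.pi) * Real.sqrt (2 / (|t - t₀| * iteratedDeriv 2 f p))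
        * Real.sqrt Real.pi := by
    rw [Real.rpow_neg hT.le, ← Real.sqrt_eq_rpow, Real.sqrt_div (by norm_num),
      Real.sqrt_mul hT.le, Real.sqrt_mul (by norm_num)]
    have h2 : Real.sqrt 2 * Real.sqrt 2 = 2 := Real.mul_self_sqrt (by norm_num)
    have h3 : Real.sqrt Real.pi * Real.sqrt Real.pi = Real.pi := Real.mul_self_sqrt hpi.le
    have h4 : Real.sqrt |t - t₀| ≠ 0 := (Real.sqrt_pos.2 hT).ne'
    have h5 : Real.sqrt (iteratedDeriv 2 f p) ≠ 0 := (Real.sqrt_pos.2 hp).ne'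
    have h6 : Real.sqrt 2 ≠ 0 := by positivity
    have h7 : Real.sqrt Real.pi ≠ 0 := (Real.sqrt_pos.2 hpi).ne'
    field_simp
    linear_combination (-(Real.sqrt Real.pi * Real.sqrt Real.pi)) * h2 - 2 * h3
  have e2' := congrArg (fun r : ℝ => (r : ℂ)) e2
  push_cast at e2'
  rw [e1, originProfile]
  push_cast
  linear_combination (Complex.exp (-(Complex.I * ((t - t₀) * f p - (x - x₀) * p)))
    * Complex.exp ((x₀ * p - t₀ * f p) * Complex.I)
    * Complex.exp (-(Real.sign (t - t₀) * Complex.I * (Real.pi / 4))) * fourierT u₀ p) * e2'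

/-- The expansion inside a cone with arbitrary origin. -/
theorem norm_wave_sub_firstTerm_le (hf : ContDiff ℝ (⊤ : ℕ∞) f)
    (hconv : ∀ p : ℝ, 0 < iteratedDeriv 2 f p)
    {a b : ℝ} (hap : a < p₁) (hp : p₁ < p₂) (hpb : p₂ < b)
    (hsupp : tsupport (fourierT u₀) ⊆ Icc p₁ p₂) {δ : ℝ} (hδ : δ ∈ Ioo (1 / 2 : ℝ) (3 / 4))
    {t₀ x₀ t x : ℝ} (hz : (t, x) ∈ cone f a b t₀ x₀) :
    ‖wave f u₀ t x - firstTerm f u₀ t₀ x₀ t x‖ ≤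
      innerBound f u₀ δ a b (lpNorm (weighted f u₀ t₀ x₀) 2 volume) |t - t₀| := by
  have hab : a < b := hap.trans (hp.trans hpb)
  have ht : t - t₀ ≠ 0 := sub_ne_zero.2 hz.1
  obtain ⟨hmem, hcrit⟩ := exists_statPoint hf hconv hab.le hz
  have c2 := continuous_iteratedDeriv_of_smooth hf 2
  have c3 := continuous_iteratedDeriv_of_smooth hf 3
  have ha : a ∈ Icc a b := ⟨le_rfl, hab.le⟩
  have hm := minOn_pos c2 hab.le hconv
  have hmM : minOn (iteratedDeriv 2 f) a b ≤ supNorm (iteratedDeriv 2 f) a b :=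
    (minOn_le c2 ha).trans ((le_abs_self _).trans (norm_le_supNorm c2 hab ha))
  have hM3 : 0 ≤ supNorm (iteratedDeriv 3 f) a b := lpNorm_nonneg
  have key := norm_integral_sub_le_of_ne_zero hf hconv hab ht hmem hcrit
    (fun q => hasDerivAt_originProfile (u₀ := u₀) hf t₀ x₀ q)
    (continuous_originProfileDeriv hf t₀ x₀)
    (integrable_norm_sq_originProfileDeriv hf hsupp t₀ x₀)
    (originProfile_eq_zero hsupp (fun h => absurd h.1 (not_lt.2 hap.le)) t₀ x₀)
    (originProfile_eq_zero hsupp (fun h => absurd h.2 (not_lt.2 hpb.le)) t₀ x₀)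
    (norm_originProfile_le_lpNorm t₀ x₀) hδ
  -- Plancherel replaces the derivative norm of the amplitude by `N(t₀,x₀)`.
  rw [integral_norm_sq_originProfileDeriv hf hsupp] at key
  have halg := two_mul_phaseBound_le (ℓ := b - a) (N := lpNorm (weighted f u₀ t₀ x₀) 2 volume)
    (B := lpNorm u₀ 1 volume) hδ (abs_pos.2 ht) hm hmM hM3 (sub_pos.2 hab) lpNorm_nonneg
    lpNorm_nonneg
  rw [wave_eq_intervalIntegral hsupp hap.le hpb.le t₀ x₀, firstTerm_eq hconv ht, ← mul_sub,
    norm_mul]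
  have hn : ‖(1 / (2 * Real.pi) : ℂ)‖ = 1 / (2 * Real.pi) := by
    rw [show (1 / (2 * Real.pi) : ℂ) = ((1 / (2 * Real.pi) : ℝ) : ℂ) by push_cast; rfl,
      Complex.norm_real, Real.norm_of_nonneg (by positivity)]
  rw [hn]
  refine (mul_le_mul_of_nonneg_left key (by positivity)).trans (halg.trans_eq ?_)
  simp only [innerBound, constC5, constC6, smallC5, smallC6]

/-- The nonstationary phase estimate for the phase `T f(q) - X q`, of either sign of `T`. -/
theorem norm_integral_le_of_ne_zero (hf : ContDiff ℝ (⊤ : ℕ∞) f)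
    (hconv : ∀ p : ℝ, 0 < iteratedDeriv 2 f p) {c d T X μ : ℝ} (hcd : c ≤ d) (hT : T ≠ 0)
    (hμ : 0 < μ) (hlow : (∀ q ∈ Icc c d, μ ≤ deriv f q - X / T) ∨
      ∀ q ∈ Icc c d, deriv f q - X / T ≤ -μ) {U U' : ℝ → ℂ}
    (hU : ∀ q, HasDerivAt U (U' q) q) (hU' : Continuous U')
    (hE : Integrable (fun q => ‖U' q‖ ^ 2)) (hUc : U c = 0) (hUd : U d = 0) {B : ℝ}
    (hB : ∀ q, ‖U q‖ ≤ B) :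
    ‖∫ q in c..d, U q * Complex.exp (-(Complex.I * ((T * f q - X * q : ℝ) : ℂ)))‖ ≤
      (Real.sqrt (d - c) * Real.sqrt (∫ q, ‖U' q‖ ^ 2) + B) / (|T| * μ) := by
  have c2 := continuous_iteratedDeriv_of_smooth hf 2
  have df : ∀ q, HasDerivAt f (deriv f q) q := fun q => (hf.differentiable (by simp) q).hasDerivAt
  have hT0 := abs_pos.2 hT
  have key : ∀ (s : ℝ) (V V' : ℝ → ℂ), s * T = |T| → (∀ q, HasDerivAt V (V' q) q) → Continuous V' →
      (∀ q, ‖V' q‖ = ‖U' q‖) → (∀ q, ‖V q‖ = ‖U q‖) →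
      ‖∫ q in c..d, V q * Complex.exp (-(Complex.I * ((s * (T * f q - X * q) : ℝ) : ℂ)))‖ ≤
        (Real.sqrt (d - c) * Real.sqrt (∫ q, ‖U' q‖ ^ 2) + B) / (|T| * μ) := by
    intro s V V' hs hV hV' hn' hn
    have hg₁ : ∀ q, s * (T * deriv f q - X) = |T| * (deriv f q - X / T) := by
      intro q
      rw [← hs]
      field_simp
    have := norm_integral_le_of_lower_bound (g := fun q => s * (T * f q - X * q))
      (g₁ := fun q => s * (T * deriv f q - X)) (g₂ := fun q => |T| * iteratedDeriv 2 f q)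
      (μ := |T| * μ) (B := B) hcd
      (fun q => ((((df q).const_mul T).sub ((hasDerivAt_id q).const_mul X)).const_mul s).congr_deriv
        (by simp))
      (fun q => ((((hasDerivAt_deriv hf q).const_mul T).sub_const X).const_mul s).congr_deriv
        (by rw [← mul_assoc, hs])) (by fun_prop) (by positivity)
      (by
        simp only [hg₁, ← mul_neg]
        exact hlow.imp (fun h q hq => mul_le_mul_of_nonneg_left (h q hq) hT0.le)
          (fun h q hq => mul_le_mul_of_nonneg_left (h q hq) hT0.le))
      (fun q _ => mul_nonneg hT0.le (hconv q).le) hV hV' (by simpa only [hn'] using hE)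
      (norm_eq_zero.1 (by rw [hn, hUc, norm_zero])) (norm_eq_zero.1 (by rw [hn, hUd, norm_zero]))
      (fun q => (hn q).trans_le (hB q))
    simpa only [hn'] using this
  rcases lt_or_gt_of_ne hT with h | h
  · have := key (-1) (fun q => (starRingEnd ℂ) (U q)) (fun q => (starRingEnd ℂ) (U' q))
      (by rw [abs_of_neg h]; ring) (fun q => (hU q).star)
      (Complex.continuous_conj.comp hU') (fun q => by simp) (fun q => by simp)
    rw [← Complex.norm_conj, conj_intervalIntegral]
    simp only [conj_integrand]
    simpa only [neg_one_mul] using this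
  · have := key 1 U U' (by rw [abs_of_pos h, one_mul]) hU hU' (fun q => rfl) (fun q => rfl)
    simpa only [one_mul] using this

/-- The estimate outside a cone with arbitrary origin. -/
theorem norm_wave_le_outerBound (hf : ContDiff ℝ (⊤ : ℕ∞) f)
    (hconv : ∀ p : ℝ, 0 < iteratedDeriv 2 f p)
    {a b : ℝ} (hap : a < p₁) (hp : p₁ < p₂) (hpb : p₂ < b)
    (hsupp : tsupport (fourierT u₀) ⊆ Icc p₁ p₂)
    {t₀ x₀ t x : ℝ} (hz : (t, x) ∈ coneCompl f a b t₀ x₀) :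
    ‖wave f u₀ t x‖ ≤
      outerBound f u₀ p₁ p₂ a b (lpNorm (weighted f u₀ t₀ x₀) 2 volume) |t - t₀| := by
  obtain ⟨ht0, hz⟩ := hz
  have ht : t - t₀ ≠ 0 := sub_ne_zero.2 ht0
  have hmono := strictMono_deriv hf hconv
  set μ := min (deriv f p₁ - deriv f a) (deriv f b - deriv f p₂) with hμ
  have hμ0 : 0 < μ := lt_min (sub_pos.2 (hmono hap)) (sub_pos.2 (hmono hpb))
  -- Outside the cone the velocity lies below `f'(a)` or above `f'(b)`; monotonicity of `f'` keeps
  -- it at distance at least `μ` from every velocity in `[p₁,p₂]`.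
  have hlow : (∀ q ∈ Icc p₁ p₂, μ ≤ deriv f q - (x - x₀) / (t - t₀)) ∨
      ∀ q ∈ Icc p₁ p₂, deriv f q - (x - x₀) / (t - t₀) ≤ -μ := by
    by_cases h1 : deriv f a ≤ (x - x₀) / (t - t₀)
    · right
      have h2 : deriv f b < (x - x₀) / (t - t₀) := by
        by_contra! h2
        exact hz ⟨ht0, h1, h2⟩
      intro q hq
      have := hmono.monotone hq.2
      have := min_le_right (deriv f p₁ - deriv f a) (deriv f b - deriv f p₂)
      linarith
    · left
      intro q hq
      have := hmono.monotone hq.1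
      have := min_le_left (deriv f p₁ - deriv f a) (deriv f b - deriv f p₂)
      linarith
  have key := norm_integral_le_of_ne_zero hf hconv hp.le ht hμ0 hlow
    (fun q => hasDerivAt_originProfile (u₀ := u₀) hf t₀ x₀ q)
    (continuous_originProfileDeriv hf t₀ x₀)
    (integrable_norm_sq_originProfileDeriv hf hsupp t₀ x₀)
    (originProfile_eq_zero hsupp (fun h => absurd h.1 (lt_irrefl _)) t₀ x₀)
    (originProfile_eq_zero hsupp (fun h => absurd h.2 (lt_irrefl _)) t₀ x₀)
    (norm_originProfile_le_lpNorm t₀ x₀)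
  rw [integral_norm_sq_originProfileDeriv hf hsupp, Real.sqrt_mul (by positivity),
    Real.sqrt_sq lpNorm_nonneg] at key
  rw [wave_eq_intervalIntegral hsupp le_rfl le_rfl t₀ x₀, norm_mul]
  have hn : ‖(1 / (2 * Real.pi) : ℂ)‖ = 1 / (2 * Real.pi) := by
    rw [show (1 / (2 * Real.pi) : ℂ) = ((1 / (2 * Real.pi) : ℝ) : ℂ) by push_cast; rfl,
      Complex.norm_real, Real.norm_of_nonneg (by positivity)]
  rw [hn]
  refine (mul_le_mul_of_nonneg_left key (by positivity)).trans_eq ?_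
  rw [outerBound, constC7, constC8, ← hμ]
  have hT := abs_pos.2 ht
  have hs : Real.sqrt (2 * Real.pi) * Real.sqrt (2 * Real.pi) = 2 * Real.pi :=
    Real.mul_self_sqrt (by positivity)
  have hs0 : Real.sqrt (2 * Real.pi) ≠ 0 := by positivity
  have h1 : 1 / (2 * Real.pi) * Real.sqrt (2 * Real.pi) = 1 / Real.sqrt (2 * Real.pi) := by
    rw [div_mul_eq_mul_div, one_mul, div_eq_div_iff (by positivity) hs0, one_mul, hs]
  rw [← h1]
  field_simp

lemma constC5_nonneg {δ a b : ℝ} (hf : ContDiff ℝ (⊤ : ℕ∞) f)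
    (hconv : ∀ p : ℝ, 0 < iteratedDeriv 2 f p) (hab : a < b) :
    0 ≤ constC5 f δ a b := by
  have hm := minOn_pos (continuous_iteratedDeriv_of_smooth hf 2) hab.le hconv
  have hM : 0 ≤ supNorm (iteratedDeriv 2 f) a b := lpNorm_nonneg
  have hL := constL_pos δ
  have hl := sub_pos.2 hab
  unfold constC5 smallC5
  positivity

lemma constC7_nonneg {a b : ℝ} (hf : ContDiff ℝ (⊤ : ℕ∞) f)
    (hconv : ∀ p : ℝ, 0 < iteratedDeriv 2 f p) (hap : a < p₁) (hpb : p₂ < b) :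
    0 ≤ constC7 f p₁ p₂ a b := by
  have hmono := strictMono_deriv hf hconv
  have : 0 < min (deriv f p₁ - deriv f a) (deriv f b - deriv f p₂) :=
    lt_min (sub_pos.2 (hmono hap)) (sub_pos.2 (hmono hpb))
  unfold constC7
  positivity

lemma innerBound_mono {δ a b : ℝ} (hf : ContDiff ℝ (⊤ : ℕ∞) f)
    (hconv : ∀ p : ℝ, 0 < iteratedDeriv 2 f p) (hab : a < b)
    {w w' r : ℝ} (hr : 0 < r) (hw : w ≤ w') :
    innerBound f u₀ δ a b w r ≤ innerBound f u₀ δ a b w' r := by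
  have := constC5_nonneg (δ := δ) hf hconv hab
  unfold innerBound
  gcongr

lemma outerBound_mono {a b : ℝ} (hf : ContDiff ℝ (⊤ : ℕ∞) f)
    (hconv : ∀ p : ℝ, 0 < iteratedDeriv 2 f p) (hap : a < p₁) (hpb : p₂ < b)
    {w w' r : ℝ} (hr : 0 < r) (hw : w ≤ w') :
    outerBound f u₀ p₁ p₂ a b w r ≤ outerBound f u₀ p₁ p₂ a b w' r := by
  have := constC7_nonneg hf hconv hap hpb
  unfold outerBound
  gcongr

end

end

end WavePacket

/-! ### The optimal cone origin -/

theorem corollary3p7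
    (f : ℝ → ℝ) (hf : f.HasTemperateGrowth) (hconv : ∀ p : ℝ, 0 < iteratedDeriv 2 f p)
    (p₁ p₂ a b : ℝ) (hap : a < p₁) (hp : p₁ < p₂) (hpb : p₂ < b)
    (u₀ : 𝓢(ℝ, ℂ)) (hsupp : tsupport (WavePacket.fourierT u₀) ⊆ Icc p₁ p₂)
    (hnorm : lpNorm (u₀ : ℝ → ℂ) 2 volume = 1) :
    -- all the quantities below are well defined
    (∀ τ : ℝ, WavePacket.HasVariance (WavePacket.wave f u₀ τ) ∧
      0 ≤ WavePacket.variance (WavePacket.wave f u₀ τ)) ∧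
    (∀ t₀ x₀ : ℝ, MemLp (WavePacket.weighted f u₀ t₀ x₀) 2 volume) ∧
    ∃ tstar xstar σ : ℝ,
      -- `tstar` is the unique minimiser of the variance and `xstar` is the mean at that time
      (∀ τ : ℝ, τ ≠ tstar → WavePacket.variance (WavePacket.wave f u₀ tstar) <
        WavePacket.variance (WavePacket.wave f u₀ τ)) ∧
      xstar = WavePacket.mean (WavePacket.wave f u₀ tstar) ∧
      -- `σ` is the minimal standard deviation, and the value of the weight at `(tstar, xstar)`
      IsLeast (range fun τ : ℝ => Real.sqrt (WavePacket.variance (WavePacket.wave f u₀ τ))) σ ∧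
      lpNorm (WavePacket.weighted f u₀ tstar xstar) 2 volume = σ ∧
      -- both bounds, at any given elapsed time, are minimal for the origin `(tstar, xstar)`
      (∀ δ ∈ Ioo (1 / 2 : ℝ) (3 / 4), ∀ r : ℝ, 0 < r → ∀ t₀ x₀ : ℝ,
        WavePacket.innerBound f u₀ δ a b
            (lpNorm (WavePacket.weighted f u₀ tstar xstar) 2 volume) r ≤
          WavePacket.innerBound f u₀ δ a b
            (lpNorm (WavePacket.weighted f u₀ t₀ x₀) 2 volume) r) ∧
      (∀ r : ℝ, 0 < r → ∀ t₀ x₀ : ℝ,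
        WavePacket.outerBound f u₀ p₁ p₂ a b
            (lpNorm (WavePacket.weighted f u₀ tstar xstar) 2 volume) r ≤
          WavePacket.outerBound f u₀ p₁ p₂ a b
            (lpNorm (WavePacket.weighted f u₀ t₀ x₀) 2 volume) r) ∧
      -- the expansion inside the cone
      (∀ δ ∈ Ioo (1 / 2 : ℝ) (3 / 4), ∀ t x : ℝ, (t, x) ∈ WavePacket.cone f a b tstar xstar →
        ‖WavePacket.wave f u₀ t x - WavePacket.firstTerm f u₀ tstar xstar t x‖ ≤
          WavePacket.innerBound f u₀ δ a b σ |t - tstar|) ∧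
      -- the estimate outside the cone
      (∀ t x : ℝ, (t, x) ∈ WavePacket.coneCompl f a b tstar xstar →
        ‖WavePacket.wave f u₀ t x‖ ≤
          WavePacket.outerBound f u₀ p₁ p₂ a b σ |t - tstar|) := by
  have hs : ContDiff ℝ (⊤ : ℕ∞) f := hf.1
  have hab : a < b := hap.trans (hp.trans hpb)
  have hN := WavePacket.lpNorm_weighted_sq_eq_variance hs hsupp hnorm
  -- With `x₀` at the mean, the parallel axis identity exhibits the variance as a squared norm.
  have hV0 : ∀ τ, 0 ≤ WavePacket.variance (WavePacket.wave f u₀ τ) := fun τ => by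
    have := hN τ (WavePacket.mean (WavePacket.wave f u₀ τ))
    rw [sub_self, zero_pow two_ne_zero, add_zero] at this
    rw [← this]
    positivity
  obtain ⟨κ, tstar, v, hκ, hV⟩ := WavePacket.exists_variance_eq hs
    (WavePacket.strictMono_deriv hs hconv).injective hsupp hnorm
  have hmin : ∀ τ, WavePacket.variance (WavePacket.wave f u₀ tstar) ≤
      WavePacket.variance (WavePacket.wave f u₀ τ) := fun τ => by
    rw [hV, hV]
    nlinarith [mul_nonneg hκ.le (sq_nonneg (τ - tstar))]
  set xstar := WavePacket.mean (WavePacket.wave f u₀ tstar) with hx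
  set σ := lpNorm (WavePacket.weighted f u₀ tstar xstar) 2 volume with hσ
  have hσ2 : σ ^ 2 = WavePacket.variance (WavePacket.wave f u₀ tstar) := by
    rw [hσ, hN, hx, sub_self, zero_pow two_ne_zero, add_zero]
  have hσ0 : 0 ≤ σ := lpNorm_nonneg
  have hσs : Real.sqrt (WavePacket.variance (WavePacket.wave f u₀ tstar)) = σ := by
    rw [← hσ2, Real.sqrt_sq hσ0]
  -- Both summands of the parallel axis identity are minimised at once at `(tstar, xstar)`: the
  -- variance by the choice of time, the squared distance because it is zero.
  have hle : ∀ t₀ x₀, σ ≤ lpNorm (WavePacket.weighted f u₀ t₀ x₀) 2 volume := fun t₀ x₀ => by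
    refine (sq_le_sq₀ hσ0 lpNorm_nonneg).1 ?_
    rw [hσ2, hN]
    nlinarith [hmin t₀, sq_nonneg (x₀ - WavePacket.mean (WavePacket.wave f u₀ t₀))]
  refine ⟨fun τ => ⟨WavePacket.hasVariance_wave hs hsupp hnorm τ, hV0 τ⟩,
    WavePacket.memLp_weighted hs hsupp, tstar, xstar, σ, fun τ hτ => ?_, rfl,
    ⟨⟨tstar, hσs⟩, ?_⟩, rfl, fun δ _ r hr t₀ x₀ => ?_, fun r hr t₀ x₀ => ?_,
    fun δ hδ t x hz => ?_, fun t x hz => ?_⟩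
  · rw [hV, hV]
    have : 0 < κ * (τ - tstar) ^ 2 := by
      have := sub_ne_zero.2 hτ
      positivity
    rw [sub_self]
    linarith
  · rintro _ ⟨τ, rfl⟩
    rw [← hσs]
    exact Real.sqrt_le_sqrt (hmin τ)
  · exact WavePacket.innerBound_mono hs hconv hab hr (hle t₀ x₀)
  · exact WavePacket.outerBound_mono hs hconv hap hpb hr (hle t₀ x₀)
  · exact WavePacket.norm_wave_sub_firstTerm_le hs hconv hap hp hpb hsupp hδ hz
  · exact WavePacket.norm_wave_le_outerBound hs hconv hap hp hpb hsupp hz
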